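/- Let $\mathbb{D}$ be the open unit disc, $\mathbb{T}$ the unit circle, and let $\varphi:\mathbb{D}\to\mathbb{D}$ be a hyperbolic automorphism, i.e. a bijective linear fractional self-map of $\mathbb{D}$ having exactly two fixed points in the Riemann sphere, both of them on $\mathbb{T}$. Let $1<p<\infty$ and let $H^p(\mathbb{D})$ be the Hardy space of holomorphic functions $f$ on $\mathbb{D}$ with finite norm $\|f\|=\lim_{r\to1^-}\big(\frac1{2\pi}\int_0^{2\pi}|f(re^{i\theta})|^p\,d\theta\big)^{1/p}$. Let $C_\varphi: f\mapsto f\circ\varphi$ be the composition operator induced by $\varphi$, which is a bounded operator on $H^p(\mathbb{D})$, and let $C_\varphi^*$ be its Banach space adjoint, acting on the dual space $H^p(\mathbb{D})^*$. For a bounded operator $T$ on a complex Banach space $X$, write $\sigma(T)$ for the spectrum and $r(T)$ for the spectral radius. For $x\in X$, the local spectrum $\sigma_T(x)$ is the complement of the union of all open sets $U\subset\mathbb{C}$ on which there is an analytic $g:U\to X$ with $(T-zI)g(z)=x$ for all $z\in U$. For $F\subseteq\mathbb{C}$ let $X_T(F)=\{x\in X:\sigma_T(x)\subseteq F\}$,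 and let $r_T(x)=\limsup_{n\to\infty}\|T^nx\|^{1/n}$. Then, with $X=H^p(\mathbb{D})^*$ and $T=C_\varphi^*$: (i) the point spectrum (set of eigenvalues) of $C_\varphi^*$ is empty; (ii) $X_{C_\varphi^*}(F)=\{0\}$ for every closed set $F\subsetneq\sigma(C_\varphi^*)$; (iii) $\sigma_{C_\varphi^*}(f)=\sigma(C_\varphi^*)$ for every non-zero $f\in H^p(\mathbb{D})^*$; (iv) $r_{C_\varphi^*}(f)=r(C_\varphi^*)$ for every non-zero $f\in H^p(\mathbb{D})^*$; (v) the spectral radius $R=r(C_\varphi^*)$ satisfies $R>1$ and $\sigma(C_\varphi^*)$ is the closed annulus $\{\lambda\in\mathbb{C}: R^{-1}\le|\lambda|\le R\}$; and if $M\ne\{0\}$ is any closed subspace of $H^p(\mathbb{D})^*$ with $C_\varphi^*M\subseteq M$, then $$\sigma(C_\varphi^*|_M)=\sigma(C_\varphi^*)\quad\text{or}\quad\sigma(C_\varphi^*|_M)=\{\lambda\in\mathbb{C}:|\lambda|\le r(C_\varphi^*)\}.$$ -/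

import Mathlib

open Complex MeasureTheory Set Metric Filter
open scoped ENNReal NNReal Complex.UnitDisc

noncomputable section

namespace HardyComp

/-! ### Hardy spaces of the unit disc -/

/-- The extension by zero to `ℂ` of a function on the open unit disc. -/
def discExtend (f : 𝔻 → ℂ) (z : ℂ) : ℂ :=
  if h : ‖z‖ < 1 then f (UnitDisc.mk z h) else 0

/-- Normalized arc length measure `dθ / 2π` on `(0, 2π]`. -/
def arcMeasure : Measure ℝ :=
  (ENNReal.ofReal (2 * Real.pi))⁻¹ • volume.restrict (Ioc 0 (2 * Real.pi))

/-- The integral mean `M_p(r, f) = ((1/2π) ∫₀^{2π} |f(r e^{iθ})|^p dθ)^{1/p}`, with values in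
`[0, ∞]` (for `p = ∞` it is the essential supremum of `|f|` on the circle of radius `r`). -/
def integralMean (p : ℝ≥0∞) (f : 𝔻 → ℂ) (r : ℝ) : ℝ≥0∞ :=
  eLpNorm (fun θ : ℝ => discExtend f (r * Complex.exp (θ * I))) p arcMeasure

/-- The Hardy norm with values in `[0, ∞]`. For holomorphic `f` the integral means increase with
`r`, so that the supremum over `0 ≤ r < 1` is the limit as `r → 1⁻`. -/
def hardyENorm (p : ℝ≥0∞) (f : 𝔻 → ℂ) : ℝ≥0∞ :=
  ⨆ r ∈ Ico (0 : ℝ) 1, integralMean p f r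

/-- Holomorphic functions on the open unit disc. -/
def IsHolomorphic (f : 𝔻 → ℂ) : Prop :=
  DifferentiableOn ℂ (discExtend f) (ball 0 1)

theorem discExtend_coe (f : 𝔻 → ℂ) (z : 𝔻) : discExtend f z = f z := by
  have h : ‖(z : ℂ)‖ < 1 := z.norm_lt_one
  simp [discExtend, h]

theorem discExtend_zero : discExtend (0 : 𝔻 → ℂ) = 0 := by
  funext z; simp [discExtend]

theorem discExtend_add (f g : 𝔻 → ℂ) : discExtend (f + g) = discExtend f + discExtend g := by
  funext z; by_cases h : ‖z‖ < 1 <;> simp [discExtend, h]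

theorem discExtend_smul (c : ℂ) (f : 𝔻 → ℂ) : discExtend (c • f) = c • discExtend f := by
  funext z; by_cases h : ‖z‖ < 1 <;> simp [discExtend, h]

theorem continuous_circle {f : 𝔻 → ℂ} (hf : IsHolomorphic f) {r : ℝ} (hr : r ∈ Ico (0 : ℝ) 1) :
    Continuous (fun θ : ℝ => discExtend f (r * Complex.exp (θ * I))) := by
  have h2 : Continuous (fun θ : ℝ => (r : ℂ) * Complex.exp (θ * I)) := by fun_prop
  refine hf.continuousOn.comp_continuous h2 fun θ => ?_
  rw [mem_ball_zero_iff, norm_mul, Complex.norm_exp_ofReal_mul_I, mul_one, Complex.norm_real,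
    Real.norm_of_nonneg hr.1]
  exact hr.2

theorem hardyENorm_zero (p : ℝ≥0∞) : hardyENorm p 0 = 0 := by
  simp [hardyENorm, integralMean, discExtend_zero]

theorem hardyENorm_add_le {p : ℝ≥0∞} (hp : 1 ≤ p) {f g : 𝔻 → ℂ} (hf : IsHolomorphic f)
    (hg : IsHolomorphic g) : hardyENorm p (f + g) ≤ hardyENorm p f + hardyENorm p g := by
  refine iSup₂_le fun r hr => ?_
  have h : integralMean p (f + g) r ≤ integralMean p f r + integralMean p g r := by
    have := eLpNorm_add_le (μ := arcMeasure) (continuous_circle hf hr).aestronglyMeasurable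
      (continuous_circle hg hr).aestronglyMeasurable hp
    unfold integralMean
    rw [discExtend_add]
    exact this
  exact h.trans (add_le_add (le_iSup₂ (f := fun r _ => integralMean p f r) r hr)
    (le_iSup₂ (f := fun r _ => integralMean p g r) r hr))

theorem hardyENorm_smul (p : ℝ≥0∞) (c : ℂ) (f : 𝔻 → ℂ) :
    hardyENorm p (c • f) = ‖c‖ₑ * hardyENorm p f := by
  unfold hardyENorm
  simp only [ENNReal.mul_iSup]
  refine iSup_congr fun r => iSup_congr fun _ => ?_
  have := eLpNorm_const_smul c (fun θ : ℝ => discExtend f (r * Complex.exp (θ * I))) p arcMeasure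
  unfold integralMean
  rw [discExtend_smul]
  exact this

theorem hardyENorm_eq_zero {p : ℝ≥0∞} (hp : 1 ≤ p) {f : 𝔻 → ℂ} (hf : IsHolomorphic f)
    (h : hardyENorm p f = 0) : f = 0 := by
  have hp0 : p ≠ 0 := (zero_lt_one.trans_le hp).ne'
  have h0 : ∀ r ∈ Ico (0 : ℝ) 1, integralMean p f r = 0 := by
    intro r hr
    have := le_iSup₂ (f := fun r (_ : r ∈ Ico (0 : ℝ) 1) => integralMean p f r) r hr
    exact le_antisymm (this.trans h.le) bot_le
  have hpi : (0 : ℝ) < 2 * Real.pi := by positivity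
  have h1 : ∀ r ∈ Ico (0 : ℝ) 1, ∀ θ ∈ Ioc (0 : ℝ) (2 * Real.pi),
      discExtend f (r * Complex.exp (θ * I)) = 0 := by
    intro r hr
    have hc := continuous_circle hf hr
    have hz := (eLpNorm_eq_zero_iff hc.aestronglyMeasurable hp0).1 (h0 r hr)
    rw [arcMeasure, Measure.ae_ennreal_smul_measure_eq
      (ENNReal.inv_ne_zero.2 ENNReal.ofReal_ne_top)] at hz
    exact Measure.eqOn_Ioc_of_ae_eq volume hz hc.continuousOn continuous_const.continuousOn
  funext z
  have hz := h1 ‖(z : ℂ)‖ ⟨norm_nonneg _, z.norm_lt_one⟩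
  rw [← discExtend_coe f z, Pi.zero_apply]
  obtain ⟨θ, hθ, hθ'⟩ : ∃ θ ∈ Ioc (0 : ℝ) (2 * Real.pi),
      (‖(z : ℂ)‖ : ℂ) * Complex.exp (θ * I) = z := by
    have hper := Complex.norm_mul_exp_arg_mul_I (z : ℂ)
    rcases le_or_gt (arg (z : ℂ)) 0 with ha | ha
    · refine ⟨arg (z : ℂ) + 2 * Real.pi, ⟨?_, by linarith⟩, ?_⟩
      · have := neg_pi_lt_arg (z : ℂ); have := Real.pi_pos; linarith
      · have e : ((arg (z : ℂ) + 2 * Real.pi : ℝ) : ℂ) * I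
            = arg (z : ℂ) * I + 2 * Real.pi * I := by push_cast; ring
        rw [e, Complex.exp_add, Complex.exp_two_pi_mul_I, mul_one, hper]
    · exact ⟨arg (z : ℂ), ⟨ha, by have := arg_le_pi (z : ℂ); linarith⟩, hper⟩
  rw [← hθ']
  exact hz θ hθ

/-- `H^p(𝔻)` as a space of functions: the holomorphic `f` with finite Hardy norm. -/
def hardySubmodule (p : ℝ≥0∞) [hp : Fact (1 ≤ p)] : Submodule ℂ (𝔻 → ℂ) where
  carrier := {f | IsHolomorphic f ∧ hardyENorm p f < ⊤}
  zero_mem' := by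
    refine ⟨?_, by simp [hardyENorm_zero]⟩
    rw [IsHolomorphic, discExtend_zero]
    exact differentiableOn_const 0
  add_mem' := by
    rintro f g ⟨hf, hf'⟩ ⟨hg, hg'⟩
    refine ⟨?_, (hardyENorm_add_le hp.out hf hg).trans_lt (ENNReal.add_lt_top.2 ⟨hf', hg'⟩)⟩
    rw [IsHolomorphic, discExtend_add]
    exact DifferentiableOn.add hf hg
  smul_mem' := by
    rintro c f ⟨hf, hf'⟩
    refine ⟨?_, ?_⟩
    · rw [IsHolomorphic, discExtend_smul]
      exact DifferentiableOn.const_smul hf c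
    · rw [hardyENorm_smul]
      exact ENNReal.mul_lt_top enorm_lt_top hf'

/-- The Hardy space `H^p(𝔻)`, `1 ≤ p ≤ ∞`. -/
def HardySpace (p : ℝ≥0∞) [Fact (1 ≤ p)] : Type := hardySubmodule p

namespace HardySpace

variable {p : ℝ≥0∞} [Fact (1 ≤ p)]

instance : AddCommGroup (HardySpace p) := inferInstanceAs (AddCommGroup (hardySubmodule p))

instance : Module ℂ (HardySpace p) := inferInstanceAs (Module ℂ (hardySubmodule p))

instance : CoeFun (HardySpace p) (fun _ => 𝔻 → ℂ) := ⟨fun f => f.1⟩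

/-- The norm of `H^p(𝔻)`. -/
instance : NormedAddCommGroup (HardySpace p) :=
  AddGroupNorm.toNormedAddCommGroup
    { toFun := fun f => (hardyENorm p f.1).toReal
      map_zero' := by
        change (hardyENorm p 0).toReal = 0
        simp [hardyENorm_zero]
      add_le' := fun f g => by
        change (hardyENorm p (f.1 + g.1)).toReal ≤ _
        rw [← ENNReal.toReal_add f.2.2.ne g.2.2.ne]
        exact ENNReal.toReal_mono (ENNReal.add_ne_top.2 ⟨f.2.2.ne, g.2.2.ne⟩)
          (hardyENorm_add_le Fact.out f.2.1 g.2.1)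
      neg' := fun f => by
        change (hardyENorm p (-f.1)).toReal = _
        rw [← neg_one_smul ℂ f.1, hardyENorm_smul]
        simp
      eq_zero_of_map_eq_zero' := fun f hf => by
        have h : hardyENorm p f.1 = 0 :=
          ((ENNReal.toReal_eq_zero_iff _).1 hf).resolve_right f.2.2.ne
        exact Subtype.ext (hardyENorm_eq_zero Fact.out f.2.1 h) }

theorem norm_def (f : HardySpace p) : ‖f‖ = (hardyENorm p f).toReal := rfl

instance : NormedSpace ℂ (HardySpace p) where
  norm_smul_le c f := by
    change (hardyENorm p (c • f.1)).toReal ≤ ‖c‖ * (hardyENorm p f.1).toReal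
    rw [hardyENorm_smul, ENNReal.toReal_mul, toReal_enorm]

end HardySpace

/-- `C` is the composition operator `f ↦ f ∘ φ` on `H^p(𝔻)`. There is at most one such `C`. -/
def IsCompositionOperator {p : ℝ≥0∞} [Fact (1 ≤ p)] (φ : 𝔻 → 𝔻)
    (C : HardySpace p →L[ℂ] HardySpace p) : Prop :=
  ∀ (f : HardySpace p) (z : 𝔻), C f z = f (φ z)

/-- Hyperbolic automorphisms of the disc: bijective linear fractional maps
`φ(z) = (a z + b) / (c z + d)` of the disc with exactly two fixed points in the Riemann sphere,
both on the unit circle. (If the displayed set of finite fixed points has two elements, then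
`c ≠ 0`, so that `∞` is not fixed.) -/
def IsHyperbolicAutomorphism (φ : 𝔻 → 𝔻) : Prop :=
  Function.Bijective φ ∧ ∃ a b c d : ℂ, a * d - b * c ≠ 0 ∧
    (∀ z : 𝔻, c * z + d ≠ 0 ∧ (φ z : ℂ) = (a * z + b) / (c * z + d)) ∧
    ∃ ζ ξ : ℂ, ‖ζ‖ = 1 ∧ ‖ξ‖ = 1 ∧ ζ ≠ ξ ∧
      {z : ℂ | c * z + d ≠ 0 ∧ (a * z + b) / (c * z + d) = z} = {ζ, ξ}

/-! ### Adjoints and local spectral theory -/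

section LocalSpectralTheory

variable {X : Type*} [NormedAddCommGroup X] [NormedSpace ℂ X]

/-- The Banach space adjoint `T* : X* → X*`, `T* ξ = ξ ∘ T`. -/
def dualOperator (T : X →L[ℂ] X) : StrongDual ℂ X →L[ℂ] StrongDual ℂ X :=
  ContinuousLinearMap.precomp ℂ T

/-- The point spectrum: the set of eigenvalues. -/
def pointSpectrum (T : X →L[ℂ] X) : Set ℂ :=
  {μ | Module.End.HasEigenvalue (T : Module.End ℂ X) μ}

/-- The local resolvent set `ρ_T(x)`: the union of the open sets `U` carrying an analytic
`g : U → X` with `(T - z) g(z) = x` on `U`. -/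
def localResolventSet (T : X →L[ℂ] X) (x : X) : Set ℂ :=
  ⋃₀ {U | IsOpen U ∧ ∃ g : ℂ → X, AnalyticOnNhd ℂ g U ∧ ∀ z ∈ U, T (g z) - z • g z = x}

/-- The local spectrum `σ_T(x)`. -/
def localSpectrum (T : X →L[ℂ] X) (x : X) : Set ℂ := (localResolventSet T x)ᶜ

/-- The local spectral subspace `X_T(F)`. -/
def localSpectralSubspace (T : X →L[ℂ] X) (F : Set ℂ) : Set X := {x | localSpectrum T x ⊆ F}

/-- The local spectral radius `limsup ‖Tⁿ x‖^{1/n}`, as an element of `[0, ∞]`. -/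
def localSpectralRadius (T : X →L[ℂ] X) (x : X) : ℝ≥0∞ :=
  limsup (fun n : ℕ => ‖(T ^ n) x‖ₑ ^ (1 / n : ℝ)) atTop

/-- The spectrum `σ(T|_M)` of the restriction `T|_M : M → M` of `T` to an invariant subspace. -/
def restrictionSpectrum (T : X →L[ℂ] X) (M : Submodule ℂ X) (hM : ∀ x ∈ M, T x ∈ M) : Set ℂ :=
  spectrum ℂ (T.restrict hM)

end LocalSpectralTheory

end HardyComp

end

/-!
Let `α` and `β` be the fixed points of the hyperbolic automorphism `φ`. A Möbius coordinate `v` with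
`v(α) = 0` and `v(β) = ∞` maps the disc onto the right half-plane and conjugates `φ` to
multiplication by `eˣ`, for a real `x ≠ 0` (`IsHyperbolicAutomorphism.exists_eq_flow`). So `φ`
belongs to a one-parameter group of automorphisms, and the powers `v^s` satisfy
`v^s ∘ φ = e^(sx) v^s`. They belong to `H^p` for `|Re s| < 1/p`, and depend holomorphically on `s`
there (`power_mem`, `exists_hasDerivAt_powerElt`).

For a functional `f` on `H^p` put `F(s) = f(v^s)`, a holomorphic function on the strip
`|Re s| < 1/p`. The linear span of the `v^s` is dense in `H^p`, so `F` vanishes identically only if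
`f = 0` (`eq_zero_of_forall_powerElt`). The adjoint `C_φ*` multiplies `F` by `e^(sx)`. An
eigenvector, or a local solution of `(C_φ* - z) g(z) = f` on an open set that meets the open annulus
`{e^(sx) : |Re s| < 1/p}`, would therefore make `F` vanish on an open set. So there are no
eigenvectors, and the local spectrum of every `f ≠ 0` contains the closed annulus. In the other
direction, Littlewood subordination gives `‖C_φⁿ‖ ≤ K R^|n|` for all integers `n`, with
`R = e^(|x|/p)`, which confines the spectrum of `C_φ*` to the same annulus. The lower bound for the
local spectral radius comes from `f(C_φⁿ v^s) = e^(nsx) F(s)`. The restriction of `C_φ*` to an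
invariant subspace has the annulus in its spectrum, and the hole of the annulus is a connected
subset of the resolvent set of `C_φ*`, so it lies either in the spectrum of the restriction or in
its resolvent set (`subset_resolventSet_restrict`). These arguments only use the structure
`HasAnalyticEigenfamily`.

Density of the span has two ingredients. First, polynomials are dense in `H^p` for `1 < p < ∞`,
because dilations converge in norm; this follows from uniform convexity and the monotonicity of
the power means, without boundary values (`exists_dilation_near`). Second, if `f` kills all `v^s`,
then it kills `(v + κ)⁻ⁿ`, which for a suitable constant `κ` is a multiple of `(z - β)ⁿ`: the Mellin
transform of `t ↦ (v + κ t)⁻ⁿ` is a multiple of a power of `v` (`exists_mellin_kernelElt_eq`), so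
the Mellin transform of `t ↦ f((v + κ t)⁻ⁿ)` vanishes on a vertical line, and Mellin inversion
applies.
-/

noncomputable section

namespace HardyComp

open Real (circleAverage)
open scoped Topology ComplexConjugate

/-! ### Subordination -/

/-- The tangent line inequality for the convex function `x ↦ x ^ q` at the point `a`. -/
theorem rpow_tangent_le {q : ℝ} (hq : 1 ≤ q) {a x : ℝ} (ha : 0 ≤ a) (hx : 0 ≤ x) :
    a ^ q + q * a ^ (q - 1) * (x - a) ≤ x ^ q := by
  rcases ha.eq_or_lt with rfl | ha
  · rw [Real.zero_rpow (by linarith), zero_add, sub_zero]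
    rcases hq.eq_or_lt with rfl | hq
    · simp
    · rw [Real.zero_rpow (by linarith)]
      simpa using Real.rpow_nonneg hx q
  · have h := one_add_mul_self_le_rpow_one_add (s := x / a - 1) (p := q)
      (by have : 0 ≤ x / a := by positivity
          linarith) hq
    rw [add_sub_cancel, Real.div_rpow hx ha.le, le_div_iff₀ (Real.rpow_pos_of_pos ha q)] at h
    calc a ^ q + q * a ^ (q - 1) * (x - a) = (1 + q * (x / a - 1)) * a ^ q := by
          rw [Real.rpow_sub_one ha.ne']; field_simp
      _ ≤ x ^ q := h

theorem continuousOn_re_herglotzRieszKernel {ρ : ℝ} {w : ℂ} (hw : w ∈ ball (0 : ℂ) ρ) :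
    ContinuousOn (re ∘ herglotzRieszKernel 0 w) (sphere 0 |ρ|) :=
  continuous_re.comp_continuousOn (continuousOn_herglotzRieszKernel_sphere hw)

theorem re_herglotzRieszKernel_nonneg {ρ : ℝ} {w z : ℂ} (hw : w ∈ ball (0 : ℂ) ρ)
    (hz : z ∈ sphere (0 : ℂ) |ρ|) : 0 ≤ (herglotzRieszKernel 0 w z).re := by
  rw [mem_ball_zero_iff] at hw
  have hρ : 0 < ρ := (norm_nonneg w).trans_lt hw
  rw [abs_of_pos hρ] at hz
  refine le_trans ?_ (le_re_herglotzRieszKernel (w := w) hz (by simpa using hw))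
  rw [sub_zero]
  exact div_nonneg (by linarith) (by positivity)

/-- `|F|^q` is dominated by the Poisson integral of its values on a circle. -/
theorem norm_rpow_le_poisson {q ρ : ℝ} (hq : 1 ≤ q) {F : ℂ → ℂ}
    (hF : DiffContOnCl ℂ F (ball 0 ρ)) {w : ℂ} (hw : w ∈ ball (0 : ℂ) ρ) :
    ‖F w‖ ^ q ≤ circleAverage ((re ∘ herglotzRieszKernel 0 w) • fun ζ => ‖F ζ‖ ^ q) 0 ρ := by
  have hρ : 0 < ρ := pos_of_mem_ball hw
  have hP := continuousOn_re_herglotzRieszKernel hw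
  have hFc : ContinuousOn (fun ζ => ‖F ζ‖) (sphere 0 |ρ|) := by
    rw [abs_of_pos hρ]
    exact (hF.2.mono (sphere_subset_closedBall.trans_eq (closure_ball 0 hρ.ne').symm)).norm
  have hFq : ContinuousOn (fun ζ => ‖F ζ‖ ^ q) (sphere 0 |ρ|) :=
    hFc.rpow_const fun _ _ => Or.inr (by linarith)
  set P := re ∘ herglotzRieszKernel 0 w with hPdef
  have hone : circleAverage P 0 ρ = 1 := by
    have := (diffContOnCl_const (c := (1 : ℂ)) (s := ball (0 : ℂ) ρ)
      ).circleAverage_re_herglotzRieszKernel_smul hw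
    have h2 := congrArg re this
    rw [← reCLM_apply, ← ContinuousLinearMap.circleAverage_comp_comm] at h2
    · rw [← one_re, ← h2]
      congr 1
      funext z
      simp [P]
    · refine ContinuousOn.circleIntegrable' ?_
      exact hP.smul continuousOn_const
  have hle : ‖F w‖ ≤ circleAverage (P • fun ζ => ‖F ζ‖) 0 ρ := by
    rw [← hF.circleAverage_re_herglotzRieszKernel_smul hw, circleAverage, circleAverage,
      norm_smul, Real.norm_of_nonneg (by positivity), smul_eq_mul]
    refine mul_le_mul_of_nonneg_left ?_ (by positivity)
    refine (intervalIntegral.norm_integral_le_integral_norm (by positivity)).trans_eq ?_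
    refine intervalIntegral.integral_congr fun θ _ => ?_
    have := re_herglotzRieszKernel_nonneg hw (circleMap_mem_sphere' 0 ρ θ)
    simp [P, abs_of_nonneg this]
  set a := ‖F w‖
  have hI1 : CircleIntegrable (P • fun ζ => ‖F ζ‖) 0 ρ := (hP.smul hFc).circleIntegrable'
  have hI0 : CircleIntegrable P 0 ρ := hP.circleIntegrable'
  have hmono : circleAverage ((a ^ q - q * a ^ (q - 1) * a) • P +
      (q * a ^ (q - 1)) • (P • fun ζ => ‖F ζ‖)) 0 ρ
      ≤ circleAverage (P • fun ζ => ‖F ζ‖ ^ q) 0 ρ := by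
    refine Real.circleAverage_mono ((hI0.const_smul).add hI1.const_smul)
      (hP.smul hFq).circleIntegrable' fun z hz => ?_
    have h1 := re_herglotzRieszKernel_nonneg hw hz
    have h2 := mul_le_mul_of_nonneg_left
      (rpow_tangent_le hq (norm_nonneg (F w)) (norm_nonneg (F z))) h1
    simp only [P, a, Pi.add_apply, Pi.smul_apply', Pi.smul_apply, smul_eq_mul, Pi.mul_apply,
      Function.comp_apply]
    refine le_trans (le_of_eq ?_) h2
    ring
  refine le_trans ?_ hmono
  rw [Real.circleAverage_add hI0.const_smul hI1.const_smul, Real.circleAverage_smul,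
    Real.circleAverage_smul, hone]
  have h3 : 0 ≤ q * a ^ (q - 1) := by positivity
  have h4 := mul_le_mul_of_nonneg_left hle h3
  simp only [smul_eq_mul, mul_one] at h4 ⊢
  linarith

/-- **Littlewood's subordination inequality.** The `q`-th power means of `F ∘ ψ` are controlled by
those of `F`: the Poisson integral of `|F|^q` is the real part of a holomorphic function `H`, and
the mean value property holds for `H ∘ ψ`. -/
theorem circleAverage_norm_rpow_comp_le {q ρ r : ℝ} (hq : 1 ≤ q) (hr : 0 < r) {F ψ : ℂ → ℂ}
    (hF : DiffContOnCl ℂ F (ball 0 ρ)) (hψ : DifferentiableOn ℂ ψ (closedBall 0 r))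
    (hψm : MapsTo ψ (closedBall 0 r) (ball 0 ρ)) :
    circleAverage (fun z => ‖F (ψ z)‖ ^ q) 0 r ≤
      (ρ + ‖ψ 0‖) / (ρ - ‖ψ 0‖) * circleAverage (fun z => ‖F z‖ ^ q) 0 ρ := by
  have h0 : ψ 0 ∈ ball (0 : ℂ) ρ := hψm (by simp [hr.le])
  have hρ : 0 < ρ := pos_of_mem_ball h0
  have hFc : ContinuousOn F (sphere 0 |ρ|) := by
    rw [abs_of_pos hρ]
    exact hF.2.mono (sphere_subset_closedBall.trans_eq (closure_ball 0 hρ.ne').symm)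
  have hFq : ContinuousOn (fun ζ => ‖F ζ‖ ^ q) (sphere 0 |ρ|) :=
    hFc.norm.rpow_const fun _ _ => Or.inr (by linarith)
  have hFC : CircleIntegrable (fun ζ => ((‖F ζ‖ ^ q : ℝ) : ℂ)) 0 ρ :=
    (continuous_ofReal.comp_continuousOn hFq).circleIntegrable'
  set H : ℂ → ℂ := fun w =>
    circleAverage (fun ζ => herglotzRieszKernel 0 w ζ • ((‖F ζ‖ ^ q : ℝ) : ℂ)) 0 ρ with hH
  have hHd : DifferentiableOn ℂ H (ball 0 ρ) :=
    differentiableOn_circleAverage_herglotzRieszKernel_smul hFC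
  have hHre : ∀ w ∈ ball (0 : ℂ) ρ, (H w).re =
      circleAverage ((re ∘ herglotzRieszKernel 0 w) • fun ζ => ‖F ζ‖ ^ q) 0 ρ := fun w hw =>
    re_circleAverage_herglotzRieszKernel_smul hFq.circleIntegrable' hw
  have hcomp : DifferentiableOn ℂ (H ∘ ψ) (closedBall 0 r) := hHd.comp hψ hψm
  have hmean : circleAverage (fun z => (H (ψ z)).re) 0 r = (H (ψ 0)).re := by
    have h1 : DiffContOnCl ℂ (H ∘ ψ) (ball 0 |r|) := by
      rw [abs_of_pos hr]
      refine DifferentiableOn.diffContOnCl ?_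
      rwa [closure_ball 0 hr.ne']
    have h2 := congrArg re h1.circleAverage
    rw [← reCLM_apply, ← ContinuousLinearMap.circleAverage_comp_comm] at h2
    · exact h2
    · refine (hcomp.continuousOn.mono ?_).circleIntegrable'
      rw [abs_of_pos hr]
      exact sphere_subset_closedBall
  have hsub : sphere (0 : ℂ) |r| ⊆ closedBall 0 r := by
    rw [abs_of_pos hr]; exact sphere_subset_closedBall
  have hFd : ContinuousOn F (ball 0 ρ) := hF.1.continuousOn
  calc circleAverage (fun z => ‖F (ψ z)‖ ^ q) 0 r
      ≤ circleAverage (fun z => (H (ψ z)).re) 0 r := by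
        refine Real.circleAverage_mono ?_ ?_ fun z hz => ?_
        · exact ContinuousOn.circleIntegrable' <| (((hFd.comp hψ.continuousOn hψm).mono
            hsub).norm.rpow_const fun _ _ => Or.inr (by linarith))
        · exact ContinuousOn.circleIntegrable' <|
            continuous_re.comp_continuousOn (hcomp.continuousOn.mono hsub)
        · rw [hHre _ (hψm (hsub hz))]
          exact norm_rpow_le_poisson hq hF (hψm (hsub hz))
    _ = (H (ψ 0)).re := hmean
    _ ≤ _ := by
        rw [hHre _ h0, ← smul_eq_mul, ← Real.circleAverage_smul]
        refine Real.circleAverage_mono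
          ((continuousOn_re_herglotzRieszKernel h0).smul hFq).circleIntegrable'
          (hFq.circleIntegrable'.const_smul) fun z hz => ?_
        refine mul_le_mul_of_nonneg_right ?_ (by positivity)
        rw [abs_of_pos hρ] at hz
        simpa [herglotzRieszKernel_def] using re_herglotzRieszKernel_le (c := 0) hz h0

/-- The `q`-th power means of a holomorphic function increase with the radius. -/
theorem circleAverage_norm_rpow_mono {q r ρ : ℝ} (hq : 1 ≤ q) (hr : 0 ≤ r) (hrρ : r ≤ ρ)
    {F : ℂ → ℂ} (hF : DiffContOnCl ℂ F (ball 0 ρ)) :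
    circleAverage (fun z => ‖F z‖ ^ q) 0 r ≤ circleAverage (fun z => ‖F z‖ ^ q) 0 ρ := by
  rcases hrρ.eq_or_lt with rfl | hlt
  · rfl
  rcases hr.eq_or_lt with rfl | hr
  · have h := norm_rpow_le_poisson hq hF (w := 0) (by simpa using hlt)
    rw [Real.circleAverage_zero]
    refine h.trans_eq (Real.circleAverage_congr_sphere fun z hz => ?_)
    have : z ≠ 0 := by
      rintro rfl
      simp [abs_of_pos hlt] at hz
      exact hlt.ne hz
    simp [herglotzRieszKernel_def, this]
  · have h := circleAverage_norm_rpow_comp_le hq hr hF (ψ := id) differentiableOn_id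
      fun z hz => closedBall_subset_ball hlt hz
    have hρ : ρ ≠ 0 := (hr.trans hlt).ne'
    simpa [div_self hρ] using h

/-! ### The Hardy space as a Banach space of functions -/

theorem discExtend_eqOn (F : ℂ → ℂ) : EqOn (discExtend fun z : 𝔻 => F z) F (ball 0 1) := by
  intro z hz
  rw [mem_ball_zero_iff] at hz
  simp [discExtend, hz]

theorem discExtend_of_norm_lt (f : 𝔻 → ℂ) {z : ℂ} (hz : ‖z‖ < 1) :
    discExtend f z = f (UnitDisc.mk z hz) := by
  simp [discExtend, hz]

theorem isHolomorphic_of_differentiableOn {F : ℂ → ℂ} (hF : DifferentiableOn ℂ F (ball 0 1)) :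
    IsHolomorphic fun z : 𝔻 => F z :=
  hF.congr fun _ hz => discExtend_eqOn F hz

theorem sphere_subset_ball_one {r : ℝ} (hr : r ∈ Ico (0 : ℝ) 1) :
    sphere (0 : ℂ) |r| ⊆ ball 0 1 := by
  rw [abs_of_nonneg hr.1]
  exact sphere_subset_closedBall.trans (closedBall_subset_ball hr.2)

theorem diffContOnCl_of_lt_one {F : ℂ → ℂ} (hF : DifferentiableOn ℂ F (ball 0 1)) {r : ℝ}
    (hr : r < 1) : DiffContOnCl ℂ F (ball 0 r) :=
  (hF.mono (closedBall_subset_ball hr)).diffContOnCl_ball subset_rfl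

theorem circleIntegrable_norm_rpow {F : ℂ → ℂ} {r q : ℝ} (hq : 0 ≤ q)
    (hF : ContinuousOn F (sphere 0 |r|)) : CircleIntegrable (fun z => ‖F z‖ ^ q) 0 r :=
  ContinuousOn.circleIntegrable' (hF.norm.rpow_const fun _ _ => Or.inr hq)

theorem integralMean_rpow {p : ℝ≥0∞} (hp0 : p ≠ 0) (hp : p ≠ ⊤) {f : 𝔻 → ℂ}
    (hf : IsHolomorphic f) {r : ℝ} (hr : r ∈ Ico (0 : ℝ) 1) :
    integralMean p f r ^ p.toReal =
      ENNReal.ofReal (circleAverage (fun z => ‖discExtend f z‖ ^ p.toReal) 0 r) := by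
  have hq : 0 < p.toReal := ENNReal.toReal_pos hp0 hp
  have hc := continuous_circle hf hr
  have hcq : Continuous fun θ : ℝ => ‖discExtend f (r * Complex.exp (θ * I))‖ ^ p.toReal :=
    hc.norm.rpow_const fun _ => Or.inr hq.le
  rw [integralMean, eLpNorm_eq_lintegral_rpow_enorm_toReal hp0 hp, ← ENNReal.rpow_mul,
    one_div_mul_cancel hq.ne', ENNReal.rpow_one, arcMeasure, lintegral_smul_measure, smul_eq_mul,
    circleAverage, smul_eq_mul,
    ENNReal.ofReal_mul (p := (2 * Real.pi)⁻¹) (by positivity), ENNReal.ofReal_inv_of_pos (by positivity),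
    intervalIntegral.integral_of_le (by positivity),
    ofReal_integral_eq_lintegral_ofReal]
  · congr 1
    refine lintegral_congr fun θ => ?_
    rw [← ofReal_norm, ENNReal.ofReal_rpow_of_nonneg (norm_nonneg _) hq.le]
    simp [circleMap]
  · have := (hcq.intervalIntegrable (μ := volume) 0 (2 * Real.pi)).1
    simpa [circleMap, IntegrableOn] using this
  · exact Eventually.of_forall fun θ => by positivity

/-- Power means on circles near the boundary suffice to bound the Hardy norm. -/
theorem hardyENorm_le {p : ℝ≥0∞} (hp1 : 1 ≤ p) (hp : p ≠ ⊤) {f : 𝔻 → ℂ}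
    (hf : IsHolomorphic f) {r₀ M : ℝ} (hr₀ : r₀ < 1) (hM : 0 ≤ M)
    (h : ∀ r ∈ Ioo r₀ 1,
      circleAverage (fun z => ‖discExtend f z‖ ^ p.toReal) 0 r ≤ M ^ p.toReal) :
    hardyENorm p f ≤ ENNReal.ofReal M := by
  have hp0 : p ≠ 0 := (zero_lt_one.trans_le hp1).ne'
  have hq : 0 < p.toReal := ENNReal.toReal_pos hp0 hp
  have hq1 : 1 ≤ p.toReal := by simpa using ENNReal.toReal_mono hp hp1
  refine iSup₂_le fun r hr => ?_
  rw [← ENNReal.rpow_le_rpow_iff hq, integralMean_rpow hp0 hp hf hr,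
    ENNReal.ofReal_rpow_of_nonneg hM hq.le]
  refine ENNReal.ofReal_le_ofReal ?_
  obtain ⟨s, hs, hs1⟩ := exists_between (max_lt hr₀ hr.2)
  refine (circleAverage_norm_rpow_mono hq1 hr.1 ((le_max_right _ _).trans hs.le)
    (diffContOnCl_of_lt_one hf hs1)).trans (h s ⟨(le_max_left _ _).trans_lt hs, hs1⟩)

theorem one_le_toReal {p : ℝ≥0∞} (hp1 : 1 ≤ p) (hp : p ≠ ⊤) : 1 ≤ p.toReal := by
  simpa using ENNReal.toReal_mono hp hp1

variable {p : ℝ≥0∞} [hp1 : Fact (1 ≤ p)]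

namespace HardySpace

@[simp] theorem coe_add (f g : HardySpace p) (z : 𝔻) : (f + g) z = f z + g z := rfl

@[simp] theorem coe_sub (f g : HardySpace p) (z : 𝔻) : (f - g) z = f z - g z := rfl

@[simp] theorem coe_smul (c : ℂ) (f : HardySpace p) (z : 𝔻) : (c • f) z = c * f z := rfl

@[ext] theorem ext {f g : HardySpace p} (h : ∀ z, f z = g z) : f = g :=
  Subtype.ext (funext h)

theorem circleAverage_le (hp : p ≠ ⊤) (f : HardySpace p) {r : ℝ} (hr : r ∈ Ico (0 : ℝ) 1) :
    circleAverage (fun z => ‖discExtend f.1 z‖ ^ p.toReal) 0 r ≤ ‖f‖ ^ p.toReal := by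
  have hp0 : p ≠ 0 := (zero_lt_one.trans_le hp1.out).ne'
  have h1 : integralMean p f.1 r ≤ hardyENorm p f.1 :=
    le_iSup₂ (f := fun r (_ : r ∈ Ico (0 : ℝ) 1) => integralMean p f.1 r) r hr
  have h2 := ENNReal.rpow_le_rpow h1 (ENNReal.toReal_nonneg (a := p))
  rw [integralMean_rpow hp0 hp f.2.1 hr] at h2
  rw [norm_def, ENNReal.toReal_rpow]
  exact (ENNReal.ofReal_le_iff_le_toReal
    (ENNReal.rpow_ne_top_of_nonneg ENNReal.toReal_nonneg f.2.2.ne)).1 h2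

theorem norm_le_of_circleAverage_le (hp : p ≠ ⊤) (f : HardySpace p) {r₀ M : ℝ} (hr₀ : r₀ < 1)
    (hM : 0 ≤ M) (h : ∀ r ∈ Ioo r₀ 1,
      circleAverage (fun z => ‖discExtend f.1 z‖ ^ p.toReal) 0 r ≤ M ^ p.toReal) :
    ‖f‖ ≤ M :=
  ENNReal.toReal_le_of_le_ofReal hM (hardyENorm_le hp1.out hp f.2.1 hr₀ hM h)

/-- The element of `H^p` given by a holomorphic function with bounded `p`-th power means. -/
def ofFun (hp : p ≠ ⊤) (F : ℂ → ℂ) (hF : DifferentiableOn ℂ F (ball 0 1)) (M : ℝ) (hM : 0 ≤ M)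
    (h : ∀ r ∈ Ioo (0 : ℝ) 1, circleAverage (fun z => ‖F z‖ ^ p.toReal) 0 r ≤ M ^ p.toReal) :
    HardySpace p :=
  ⟨fun z => F z, isHolomorphic_of_differentiableOn hF, by
    refine (hardyENorm_le hp1.out hp (isHolomorphic_of_differentiableOn hF) zero_lt_one hM
      fun r hr => ?_).trans_lt ENNReal.ofReal_lt_top
    refine le_of_eq_of_le (Real.circleAverage_congr_sphere fun z hz => ?_) (h r hr)
    simp only [discExtend_eqOn F (sphere_subset_ball_one ⟨hr.1.le, hr.2⟩ hz)]⟩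

@[simp] theorem ofFun_apply (hp : p ≠ ⊤) (F : ℂ → ℂ) (hF : DifferentiableOn ℂ F (ball 0 1)) (M : ℝ)
    (hM : 0 ≤ M) (h) (z : 𝔻) : ofFun (p := p) hp F hF M hM h z = F z := rfl

/-- The norm of an element of `H^p` in terms of any function representing it on the disc. -/
theorem norm_le_of_eqOn (hp : p ≠ ⊤) (f : HardySpace p) {F : ℂ → ℂ} (hf : ∀ z : 𝔻, f z = F z)
    {r₀ M : ℝ} (hr₀ : r₀ < 1) (hM : 0 ≤ M)
    (h : ∀ r ∈ Ioo (max r₀ 0) 1, circleAverage (fun z => ‖F z‖ ^ p.toReal) 0 r ≤ M ^ p.toReal) :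
    ‖f‖ ≤ M := by
  refine norm_le_of_circleAverage_le hp f (r₀ := max r₀ 0) (by simp [hr₀]) hM fun r hr => ?_
  have hr' : r ∈ Ico (0 : ℝ) 1 := ⟨(le_max_right _ _).trans hr.1.le, hr.2⟩
  refine le_of_eq_of_le (Real.circleAverage_congr_sphere fun z hz => ?_) (h r hr)
  have hz1 : z ∈ ball (0 : ℂ) 1 := sphere_subset_ball_one hr' hz
  have h1 : discExtend f.1 z = F z := by
    have h2 := discExtend_coe f.1 (UnitDisc.mk z (mem_ball_zero_iff.1 hz1))
    rw [UnitDisc.coe_mk] at h2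
    rw [h2]
    exact hf _
  simp only [h1]

/-- Power means on circles near the boundary recover the norm. -/
theorem exists_radius_circleAverage_gt (hp : p ≠ ⊤) (f : HardySpace p) {ε : ℝ} (hε : 0 < ε) :
    ∃ r ∈ Ioo (0 : ℝ) 1, ‖f‖ ^ p.toReal - ε <
      circleAverage (fun z => ‖discExtend f.1 z‖ ^ p.toReal) 0 r := by
  by_contra! hcon
  have hq1 := one_le_toReal hp1.out hp
  have hq0 : 0 < p.toReal := by linarith
  set N := ‖f‖ ^ p.toReal - ε
  have hN : 0 ≤ N := by
    refine le_trans ?_ (hcon (1 / 2) (by norm_num))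
    exact Real.circleAverage_nonneg_of_nonneg fun z _ => by positivity
  have h1 : ‖f‖ ≤ N ^ (1 / p.toReal) := by
    refine norm_le_of_circleAverage_le hp f zero_lt_one (by positivity) fun r hr => ?_
    rw [← Real.rpow_mul hN, one_div_mul_cancel hq0.ne', Real.rpow_one]
    exact hcon r hr
  have h2 := Real.rpow_le_rpow (norm_nonneg f) h1 hq0.le
  rw [← Real.rpow_mul hN, one_div_mul_cancel hq0.ne', Real.rpow_one] at h2
  linarith

theorem norm_apply_le (hp : p ≠ ⊤) (f : HardySpace p) (z : 𝔻) :
    ‖f z‖ ≤ 4 / (1 - ‖(z : ℂ)‖) * ‖f‖ := by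
  have hq1 := one_le_toReal hp1.out hp
  have hq0 : 0 < p.toReal := by linarith
  have hz := z.norm_lt_one
  have hz0 := norm_nonneg (z : ℂ)
  set ρ := (1 + ‖(z : ℂ)‖) / 2 with hρ
  have hρ1 : ρ < 1 := by linarith
  have hzρ : ‖(z : ℂ)‖ < ρ := by linarith
  have hρ0 : 0 < ρ := by linarith
  have hzb : (z : ℂ) ∈ ball (0 : ℂ) ρ := mem_ball_zero_iff.2 hzρ
  have hsub := sphere_subset_ball_one ⟨hρ0.le, hρ1⟩
  have hFc : ContinuousOn (fun ζ => ‖discExtend f.1 ζ‖ ^ p.toReal) (sphere 0 |ρ|) :=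
    (f.2.1.continuousOn.mono hsub).norm.rpow_const fun _ _ => Or.inr hq0.le
  have h1 := norm_rpow_le_poisson hq1 (diffContOnCl_of_lt_one f.2.1 hρ1) hzb
  rw [discExtend_coe] at h1
  have hK : 1 ≤ 4 / (1 - ‖(z : ℂ)‖) := by
    rw [le_div_iff₀ (by linarith)]; linarith
  have h2 : circleAverage ((re ∘ herglotzRieszKernel 0 (z : ℂ)) •
      fun ζ => ‖discExtend f.1 ζ‖ ^ p.toReal) 0 ρ ≤
      4 / (1 - ‖(z : ℂ)‖) * circleAverage (fun ζ => ‖discExtend f.1 ζ‖ ^ p.toReal) 0 ρ := by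
    rw [← smul_eq_mul, ← Real.circleAverage_smul]
    refine Real.circleAverage_mono
      ((continuousOn_re_herglotzRieszKernel hzb).smul hFc).circleIntegrable'
      (hFc.circleIntegrable'.const_smul) fun ζ hζ => ?_
    refine mul_le_mul_of_nonneg_right ?_ (by positivity)
    rw [abs_of_pos hρ0] at hζ
    have h3 : (herglotzRieszKernel 0 (z : ℂ) ζ).re ≤ (ρ + ‖(z : ℂ)‖) / (ρ - ‖(z : ℂ)‖) := by
      simpa [herglotzRieszKernel_def] using re_herglotzRieszKernel_le (c := 0) hζ hzb
    refine h3.trans ?_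
    rw [div_le_div_iff₀ (by linarith) (by linarith)]
    nlinarith
  have h4 : ‖f z‖ ^ p.toReal ≤ (4 / (1 - ‖(z : ℂ)‖) * ‖f‖) ^ p.toReal := by
    refine h1.trans (h2.trans ?_)
    rw [Real.mul_rpow (by linarith) (norm_nonneg f)]
    refine mul_le_mul (Real.self_le_rpow_of_one_le hK hq1) (circleAverage_le hp f ⟨hρ0.le, hρ1⟩)
      (Real.circleAverage_nonneg_of_nonneg fun z _ => by positivity) (by positivity)
  exact (Real.rpow_le_rpow_iff (norm_nonneg _) (by positivity) hq0).1 h4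

/-- Evaluation at a point of the disc. -/
def evalCLM (hp : p ≠ ⊤) (z : 𝔻) : HardySpace p →L[ℂ] ℂ :=
  LinearMap.mkContinuous ⟨⟨fun f => f z, fun _ _ => rfl⟩, fun _ _ => rfl⟩ (4 / (1 - ‖(z : ℂ)‖))
    fun f => norm_apply_le hp f z

@[simp] theorem evalCLM_apply (hp : p ≠ ⊤) (z : 𝔻) (f : HardySpace p) : evalCLM hp z f = f z := rfl

theorem norm_discExtend_le (hp : p ≠ ⊤) (f : HardySpace p) {r : ℝ} (hr : r < 1) {z : ℂ}
    (hz : ‖z‖ ≤ r) : ‖discExtend f.1 z‖ ≤ 4 / (1 - r) * ‖f‖ := by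
  have h := norm_apply_le hp f (UnitDisc.mk z (hz.trans_lt hr))
  rw [discExtend_of_norm_lt f.1 (hz.trans_lt hr)]
  refine h.trans ?_
  rw [UnitDisc.coe_mk]
  gcongr

end HardySpace

theorem tendsto_circleAverage_norm_rpow {ι : Type*} {l : Filter ι} [l.IsCountablyGenerated]
    {G : ι → ℂ → ℂ} {g : ℂ → ℂ} {r q B : ℝ} (hq : 0 ≤ q)
    (hc : ∀ᶠ i in l, ContinuousOn (G i) (sphere 0 |r|))
    (hB : ∀ᶠ i in l, ∀ z ∈ sphere (0 : ℂ) |r|, ‖G i z‖ ≤ B)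
    (hlim : ∀ z ∈ sphere (0 : ℂ) |r|, Tendsto (fun i => G i z) l (𝓝 (g z))) :
    Tendsto (fun i => circleAverage (fun z => ‖G i z‖ ^ q) 0 r) l
      (𝓝 (circleAverage (fun z => ‖g z‖ ^ q) 0 r)) := by
  unfold Real.circleAverage
  refine Tendsto.const_smul ?_ _
  refine intervalIntegral.tendsto_integral_filter_of_dominated_convergence (fun _ => |B| ^ q)
    ?_ ?_ intervalIntegrable_const ?_
  · filter_upwards [hc] with i hi
    have := circleIntegrable_norm_rpow hq hi
    exact (intervalIntegrable_iff.1 this).aestronglyMeasurable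
  · filter_upwards [hB] with i hi
    filter_upwards with θ _
    rw [Real.norm_of_nonneg (by positivity)]
    exact Real.rpow_le_rpow (norm_nonneg _)
      ((hi _ (circleMap_mem_sphere' 0 r θ)).trans (le_abs_self B)) hq
  · filter_upwards with θ _
    exact ((hlim _ (circleMap_mem_sphere' 0 r θ)).norm).rpow_const (Or.inr hq)

namespace HardySpace

/-- Completeness: a Cauchy sequence converges locally uniformly on the disc, and its limit is also
its limit in norm because the power means pass to the limit on each circle. -/
theorem completeSpace (hp : p ≠ ⊤) : CompleteSpace (HardySpace p) := by
  have hq1 := one_le_toReal hp1.out hp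
  have hq0 : 0 ≤ p.toReal := by linarith
  refine Metric.complete_of_cauchySeq_tendsto fun u hu => ?_
  have hpt : ∀ z : 𝔻, ∃ w, Tendsto (fun n => u n z) atTop (𝓝 w) := fun z =>
    cauchySeq_tendsto_of_complete
      ((evalCLM hp z).uniformContinuous.comp_cauchySeq hu)
  choose g hg using hpt
  have hgE : ∀ z ∈ ball (0 : ℂ) 1,
      Tendsto (fun n => discExtend (u n).1 z) atTop (𝓝 (discExtend g z)) := by
    intro z hz
    simpa only [discExtend_of_norm_lt _ (mem_ball_zero_iff.1 hz)] using
      hg (UnitDisc.mk z (mem_ball_zero_iff.1 hz))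
  have hC := Metric.cauchySeq_iff.1 hu
  -- the distance to the limit on compact subsets of the disc
  have hunif : ∀ ε > 0, ∃ N, ∀ n ≥ N, ∀ r < 1, ∀ z : ℂ, ‖z‖ ≤ r →
      ‖discExtend (u n).1 z - discExtend g z‖ ≤ 4 / (1 - r) * ε := by
    intro ε hε
    obtain ⟨N, hN⟩ := hC ε hε
    refine ⟨N, fun n hn r hr z hz => ?_⟩
    refine le_of_tendsto (tendsto_const_nhds.sub
      (hgE z (mem_ball_zero_iff.2 (hz.trans_lt hr)))).norm ?_
    filter_upwards [eventually_ge_atTop N] with m hm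
    have h1 := norm_discExtend_le hp (u n - u m) hr hz
    have h2 : discExtend (u n - u m).1 z = discExtend (u n).1 z - discExtend (u m).1 z := by
      have hz1 : ‖z‖ < 1 := hz.trans_lt hr
      simp only [discExtend, hz1, dite_true]
      rfl
    rw [h2] at h1
    refine h1.trans ?_
    have := (hN n hn m hm).le
    rw [dist_eq_norm] at this
    have : 0 < 1 - r := by linarith
    gcongr
  have hghol : IsHolomorphic g := by
    refine TendstoLocallyUniformlyOn.differentiableOn (φ := atTop)
      (F := fun n => discExtend (u n).1) ?_ (Eventually.of_forall fun n => (u n).2.1) isOpen_ball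
    refine (tendstoLocallyUniformlyOn_iff_forall_isCompact isOpen_ball).2 fun K hK hKc => ?_
    rcases K.eq_empty_or_nonempty with rfl | hne
    · exact tendstoUniformlyOn_empty
    obtain ⟨z₀, hz₀, hmax⟩ := hKc.exists_isMaxOn hne continuous_norm.continuousOn
    have hr : ‖z₀‖ < 1 := mem_ball_zero_iff.1 (hK hz₀)
    refine Metric.tendstoUniformlyOn_iff.2 fun ε hε => ?_
    have hr' : 0 < 1 - ‖z₀‖ := by linarith
    obtain ⟨N, hN⟩ := hunif ((1 - ‖z₀‖) / 8 * ε) (by positivity)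
    filter_upwards [eventually_ge_atTop N] with n hn z hz
    rw [dist_comm, dist_eq_norm]
    refine (hN n hn ‖z₀‖ hr z (hmax hz)).trans_lt ?_
    rw [show 4 / (1 - ‖z₀‖) * ((1 - ‖z₀‖) / 8 * ε) = ε / 2 by field_simp; norm_num]
    linarith
  have hmean : ∀ ε > 0, ∃ N, ∀ n ≥ N, ∀ r ∈ Ioo (0 : ℝ) 1,
      circleAverage (fun z => ‖discExtend ((u n).1 - g) z‖ ^ p.toReal) 0 r ≤ ε ^ p.toReal := by
    intro ε hε
    obtain ⟨N, hN⟩ := hC ε hε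
    refine ⟨N, fun n hn r hr => ?_⟩
    have hr' : r ∈ Ico (0 : ℝ) 1 := ⟨hr.1.le, hr.2⟩
    have hlim := tendsto_circleAverage_norm_rpow (l := atTop) (r := r) hq0
      (G := fun m => discExtend (u n - u m).1) (g := discExtend ((u n).1 - g))
      (B := 4 / (1 - r) * ε)
      (Eventually.of_forall fun m => (u n - u m).2.1.continuousOn.mono (sphere_subset_ball_one hr'))
      ?_ ?_
    · refine le_of_tendsto hlim ?_
      filter_upwards [eventually_ge_atTop N] with m hm
      refine (circleAverage_le hp (u n - u m) hr').trans ?_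
      have := (hN n hn m hm).le
      rw [dist_eq_norm] at this
      gcongr
    · filter_upwards [eventually_ge_atTop N] with m hm z hz
      rw [abs_of_pos hr.1, mem_sphere_zero_iff_norm] at hz
      refine (norm_discExtend_le hp (u n - u m) hr.2 hz.le).trans ?_
      have := (hN n hn m hm).le
      rw [dist_eq_norm] at this
      have : 0 < 1 - r := by linarith [hr.2]
      gcongr
    · intro z hz
      have hzb := sphere_subset_ball_one hr' hz
      have e : ∀ f : 𝔻 → ℂ, discExtend ((u n).1 - f) z =
          discExtend (u n).1 z - discExtend f z := fun f => by
        have hz1 : ‖z‖ < 1 := mem_ball_zero_iff.1 hzb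
        simp [discExtend, hz1]
      rw [e]
      refine (tendsto_const_nhds.sub (hgE z hzb)).congr fun m => ?_
      rw [← e]
      rfl
  have hsubhol : ∀ n, IsHolomorphic ((u n).1 - g) := fun n => by
    rw [sub_eq_add_neg, ← neg_one_smul ℂ g, IsHolomorphic, discExtend_add, discExtend_smul]
    exact DifferentiableOn.add (u n).2.1 (DifferentiableOn.const_smul hghol _)
  have hmem : g ∈ hardySubmodule p := by
    obtain ⟨N, hN⟩ := hmean 1 one_pos
    have h1 : (u N).1 - g ∈ hardySubmodule p :=
      ⟨hsubhol N, (hardyENorm_le hp1.out hp (hsubhol N) zero_lt_one zero_le_one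
        (hN N le_rfl)).trans_lt ENNReal.ofReal_lt_top⟩
    have h2 := (hardySubmodule p).sub_mem (u N).2 h1
    rwa [sub_sub_cancel] at h2
  obtain ⟨G, hG⟩ : ∃ G : HardySpace p, G.1 = g := ⟨(⟨g, hmem⟩ : hardySubmodule p), rfl⟩
  subst hG
  refine ⟨G, Metric.tendsto_atTop.2 fun ε hε => ?_⟩
  obtain ⟨N, hN⟩ := hmean (ε / 2) (by linarith)
  refine ⟨N, fun n hn => ?_⟩
  rw [dist_eq_norm]
  refine lt_of_le_of_lt (norm_le_of_circleAverage_le hp _ zero_lt_one (by linarith)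
    (M := ε / 2) (hN n hn)) (by linarith)

end HardySpace

/-! ### Density of the polynomials -/

theorem norm_half_add_rpow_le {q : ℝ} (hq : 1 ≤ q) (a b : ℂ) :
    ‖(a + b) / 2‖ ^ q ≤ (‖a‖ ^ q + ‖b‖ ^ q) / 2 := by
  have h1 : ‖(a + b) / 2‖ ≤ 1 / 2 * ‖a‖ + 1 / 2 * ‖b‖ := by
    rw [norm_div, Complex.norm_two]
    linarith [norm_add_le a b]
  have h2 := (convexOn_rpow hq).2 (norm_nonneg a) (norm_nonneg b)
    (by norm_num : (0 : ℝ) ≤ 1 / 2) (by norm_num : (0 : ℝ) ≤ 1 / 2) (by norm_num)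
  simp only [smul_eq_mul] at h2
  refine (Real.rpow_le_rpow (norm_nonneg _) h1 (by linarith)).trans (h2.trans (le_of_eq ?_))
  ring

theorem norm_half_add_rpow_lt {q : ℝ} (hq : 1 < q) {a b : ℂ} (hab : a ≠ b) :
    ‖(a + b) / 2‖ ^ q < (‖a‖ ^ q + ‖b‖ ^ q) / 2 := by
  have hq0 : 0 < q := by linarith
  by_cases h : ‖a‖ = ‖b‖
  · have h1 := (norm_midpoint_lt_iff h).2 hab
    have h2 : ((1 / 2 : ℝ) • (a + b)) = (a + b) / 2 := by
      rw [Complex.real_smul]; push_cast; ring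
    rw [h2] at h1
    have := Real.rpow_lt_rpow (norm_nonneg _) h1 hq0
    rw [← h]
    linarith
  · have h1 : ‖(a + b) / 2‖ ≤ 1 / 2 * ‖a‖ + 1 / 2 * ‖b‖ := by
      rw [norm_div, Complex.norm_two]
      linarith [norm_add_le a b]
    have h2 := (strictConvexOn_rpow hq).2 (norm_nonneg a) (norm_nonneg b) h
      (by norm_num : (0 : ℝ) < 1 / 2) (by norm_num : (0 : ℝ) < 1 / 2) (by norm_num)
    simp only [smul_eq_mul] at h2
    refine (Real.rpow_le_rpow (norm_nonneg _) h1 hq0.le).trans_lt (h2.trans_eq ?_)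
    ring

/-- A pointwise form of the uniform convexity of `L^q`, `1 < q < ∞`. -/
theorem exists_uniform_convexity_const {q : ℝ} (hq : 1 < q) {ε : ℝ} (hε : 0 < ε) :
    ∃ K, 0 ≤ K ∧ ∀ a b : ℂ, ‖a - b‖ ^ q ≤ ε * (‖a‖ ^ q + ‖b‖ ^ q) +
      K * ((‖a‖ ^ q + ‖b‖ ^ q) / 2 - ‖(a + b) / 2‖ ^ q) := by
  have hq0 : 0 < q := by linarith
  have hcr : ∀ f : ℂ × ℂ → ℂ, Continuous f → Continuous fun x => ‖f x‖ ^ q := fun f hf =>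
    hf.norm.rpow_const fun _ => Or.inr hq0.le
  have hc1 := hcr _ continuous_fst
  have hc2 := hcr _ continuous_snd
  have hc3 := hcr (fun x => x.1 - x.2) (by fun_prop)
  have hc4 := hcr (fun x => (x.1 + x.2) / 2) (by fun_prop)
  set S : Set (ℂ × ℂ) := {x | ‖x.1‖ ^ q + ‖x.2‖ ^ q = 1 ∧ ε ≤ ‖x.1 - x.2‖ ^ q} with hS
  have hle1 : ∀ x y : ℂ, ‖x‖ ^ q + ‖y‖ ^ q = 1 → ‖x‖ ≤ 1 := fun x y h => by
    have h1 : ‖x‖ ^ q ≤ 1 ^ q := by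
      rw [Real.one_rpow]
      linarith [Real.rpow_nonneg (norm_nonneg y) q]
    exact (Real.rpow_le_rpow_iff (norm_nonneg x) zero_le_one hq0).1 h1
  have hScl : IsClosed S := (isClosed_eq (hc1.add hc2) continuous_const).inter
    (isClosed_le continuous_const hc3)
  have hScomp : IsCompact S := by
    refine Metric.isCompact_of_isClosed_isBounded hScl
      ((isBounded_closedBall (x := (0 : ℂ × ℂ)) (r := 1)).subset fun x hx => ?_)
    rw [mem_closedBall_zero_iff, Prod.norm_def]
    refine max_le (hle1 _ _ hx.1) (hle1 x.2 x.1 ?_)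
    rw [add_comm]; exact hx.1
  have hpos : ∀ x ∈ S, (‖x.1‖ ^ q + ‖x.2‖ ^ q) / 2 - ‖(x.1 + x.2) / 2‖ ^ q ≠ 0 := by
    intro x hx
    have hne : x.1 ≠ x.2 := by
      intro h
      have := hx.2
      rw [h, sub_self, norm_zero, Real.zero_rpow hq0.ne'] at this
      linarith
    have := norm_half_add_rpow_lt hq hne
    linarith
  obtain ⟨K, hK⟩ := hScomp.exists_bound_of_continuousOn
    (f := fun x : ℂ × ℂ => ‖x.1 - x.2‖ ^ q /
      ((‖x.1‖ ^ q + ‖x.2‖ ^ q) / 2 - ‖(x.1 + x.2) / 2‖ ^ q))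
    (hc3.continuousOn.div (((hc1.add hc2).div_const 2).sub hc4).continuousOn hpos)
  have hunit : ∀ a b : ℂ, ‖a‖ ^ q + ‖b‖ ^ q = 1 → ‖a - b‖ ^ q ≤ ε +
      max K 0 * (1 / 2 - ‖(a + b) / 2‖ ^ q) := by
    intro a b hab
    have hD := norm_half_add_rpow_le hq.le a b
    rw [hab] at hD
    by_cases hmem : ε ≤ ‖a - b‖ ^ q
    · have h1 := hK (a, b) ⟨hab, hmem⟩
      have h2 := hpos (a, b) ⟨hab, hmem⟩
      simp only [hab] at h1 h2
      have h3 : 0 < 1 / 2 - ‖(a + b) / 2‖ ^ q := lt_of_le_of_ne (by linarith) h2.symm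
      rw [Real.norm_of_nonneg (by positivity), div_le_iff₀ h3] at h1
      nlinarith [le_max_left K 0]
    · have : 0 ≤ max K 0 * (1 / 2 - ‖(a + b) / 2‖ ^ q) :=
        mul_nonneg (le_max_right _ _) (by linarith)
      linarith
  refine ⟨max K 0, le_max_right _ _, fun a b => ?_⟩
  set N := ‖a‖ ^ q + ‖b‖ ^ q with hN
  have ha := Real.rpow_nonneg (norm_nonneg a) q
  have hb := Real.rpow_nonneg (norm_nonneg b) q
  rcases (add_nonneg ha hb).eq_or_lt with h0 | hNpos
  · have ha0 : ‖a‖ ^ q = 0 := by linarith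
    have hb0 : ‖b‖ ^ q = 0 := by linarith
    rw [Real.rpow_eq_zero (norm_nonneg _) hq0.ne', norm_eq_zero] at ha0 hb0
    simp [hN, ha0, hb0, Real.zero_rpow hq0.ne']
  -- both sides are homogeneous of degree `q`, so the pair can be normalized
  · change 0 < N at hNpos
    set t : ℝ := N ^ (-(1 / q)) with ht
    have htpos : 0 < t := Real.rpow_pos_of_pos hNpos _
    have htq : t ^ q = N⁻¹ := by
      rw [ht, ← Real.rpow_mul hNpos.le, neg_mul, one_div_mul_cancel hq0.ne', Real.rpow_neg_one]
    have hsc : ∀ z : ℂ, ‖(t : ℂ) * z‖ ^ q = N⁻¹ * ‖z‖ ^ q := fun z => by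
      rw [norm_mul, Complex.norm_of_nonneg htpos.le, Real.mul_rpow htpos.le (norm_nonneg z), htq]
    have h := hunit (t * a) (t * b) (by
      rw [hsc, hsc, ← mul_add, inv_mul_cancel₀ hNpos.ne'])
    rw [← mul_sub, ← mul_add, mul_div_assoc, hsc, hsc] at h
    have h2 := mul_le_mul_of_nonneg_left h hNpos.le
    rw [mul_inv_cancel_left₀ hNpos.ne'] at h2
    refine h2.trans (le_of_eq ?_)
    field_simp

theorem circleAverage_comp_mul {E : Type*} [NormedAddCommGroup E] [NormedSpace ℝ E] (G : ℂ → E)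
    (t r : ℝ) :
    circleAverage (fun z => G (t * z)) 0 r = circleAverage G 0 (t * r) := by
  simp only [circleAverage, circleMap]
  congr 1
  refine intervalIntegral.integral_congr fun θ _ => ?_
  simp [mul_assoc]

theorem differentiableOn_dilate {F : ℂ → ℂ} (hF : DifferentiableOn ℂ F (ball 0 1)) {t : ℝ}
    (ht : t ∈ Ioc (0 : ℝ) 1) : DifferentiableOn ℂ (fun z => F (t * z)) (ball 0 1) := by
  refine hF.comp (by fun_prop) fun z hz => ?_
  rw [mem_ball_zero_iff] at hz ⊢
  rw [norm_mul, Complex.norm_of_nonneg ht.1.le]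
  nlinarith [ht.2, norm_nonneg z, ht.1]

namespace HardySpace

/-- Dilations converge to the identity in `H^p`, `1 < p < ∞`: the means of `(f(t·) + f) / 2` on a
fixed circle near the boundary are almost `‖f‖` for `t` near `1`, hence so are those on all larger
circles, and uniform convexity applies. -/
theorem exists_dilation_near (hpp : 1 < p) (hp : p ≠ ⊤) (f : HardySpace p) {ε : ℝ} (hε : 0 < ε) :
    ∃ t ∈ Ioo (0 : ℝ) 1, ∃ g : HardySpace p,
      (∀ z : 𝔻, g z = discExtend f.1 (t * z)) ∧ ‖g - f‖ ≤ ε := by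
  have hq : 1 < p.toReal := by simpa using (ENNReal.toReal_lt_toReal (by simp) hp).2 hpp
  set q := p.toReal with hqdef
  have hq0 : 0 ≤ q := by linarith
  set F := discExtend f.1 with hF
  have hFd : DifferentiableOn ℂ F (ball 0 1) := f.2.1
  set N := ‖f‖ ^ q with hN
  have hN0 : 0 ≤ N := by positivity
  have hεq : 0 < ε ^ q := by positivity
  obtain ⟨K, hK0, hK⟩ := exists_uniform_convexity_const hq
    (ε := ε ^ q / (4 * (N + 1))) (by positivity)
  obtain ⟨ρ, hρ, hρN⟩ := exists_radius_circleAverage_gt hp f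
    (ε := ε ^ q / (2 * (K + 1))) (by positivity)
  have hρ' : ρ ∈ Ico (0 : ℝ) 1 := ⟨hρ.1.le, hρ.2⟩
  have hev : ∀ᶠ t : ℝ in 𝓝[<] 1, t ∈ Ioo (0 : ℝ) 1 := Ioo_mem_nhdsLT zero_lt_one
  have hmem : ∀ t ∈ Ioo (0 : ℝ) 1, ∀ z : ℂ, ‖z‖ ≤ ρ → ‖(t : ℂ) * z‖ ≤ ρ := fun t ht z hz => by
    rw [norm_mul, Complex.norm_of_nonneg ht.1.le]
    nlinarith [ht.1, ht.2, norm_nonneg z]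
  have hmid : Tendsto (fun t : ℝ => circleAverage (fun z => ‖(F (t * z) + F z) / 2‖ ^ q) 0 ρ)
      (𝓝[<] 1) (𝓝 (circleAverage (fun z => ‖F z‖ ^ q) 0 ρ)) := by
    refine tendsto_circleAverage_norm_rpow hq0 (B := 4 / (1 - ρ) * ‖f‖)
      (G := fun (t : ℝ) z => (F (t * z) + F z) / 2) ?_ ?_ ?_
    · filter_upwards [hev] with t ht
      exact (((differentiableOn_dilate hFd ⟨ht.1, ht.2.le⟩).add hFd).continuousOn.mono
        (sphere_subset_ball_one hρ')).div_const 2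
    · filter_upwards [hev] with t ht z hz
      rw [abs_of_pos hρ.1, mem_sphere_zero_iff_norm] at hz
      have h1 := norm_discExtend_le hp f hρ.2 hz.le
      have h2 := norm_discExtend_le hp f hρ.2 (hmem t ht z hz.le)
      rw [norm_div, Complex.norm_two]
      have := norm_add_le (F (t * z)) (F z)
      linarith
    · intro z hz
      have hz' := sphere_subset_ball_one hρ' hz
      have h1 : ContinuousAt F z := (hFd.differentiableAt (isOpen_ball.mem_nhds hz')).continuousAt
      have h2 : Tendsto (fun t : ℝ => (t : ℂ) * z) (𝓝[<] 1) (𝓝 z) := by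
        have : Continuous fun t : ℝ => (t : ℂ) * z := by fun_prop
        have h3 := this.tendsto 1
        simp only [ofReal_one, one_mul] at h3
        exact h3.mono_left nhdsWithin_le_nhds
      have h4 := ((h1.tendsto.comp h2).add_const (F z)).div_const 2
      rwa [add_self_div_two] at h4
  obtain ⟨t, ht1, ht⟩ := ((hmid.eventually (lt_mem_nhds hρN)).and hev).exists
  have htd := differentiableOn_dilate hFd ⟨ht.1, ht.2.le⟩
  have htmean : ∀ r ∈ Ioo (0 : ℝ) 1,
      circleAverage (fun z => ‖F (t * z)‖ ^ q) 0 r ≤ N := by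
    intro r hr
    rw [circleAverage_comp_mul (fun z => ‖F z‖ ^ q)]
    exact circleAverage_le hp f ⟨by nlinarith [ht.1, hr.1], by nlinarith [ht.1, ht.2, hr.1, hr.2]⟩
  refine ⟨t, ht, ofFun hp (fun z => F (t * z)) htd ‖f‖ (norm_nonneg f) htmean, fun z => rfl, ?_⟩
  refine norm_le_of_eqOn hp _ (F := fun z => F (t * z) - F z) (fun z => ?_) hρ.2 hε.le
    fun r hr => ?_
  · simp [hF, discExtend_coe]
  have hr0 : 0 < r := (le_max_right _ _).trans_lt hr.1
  have hρr : ρ < r := (le_max_left _ _).trans_lt hr.1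
  have hr' : r ∈ Ico (0 : ℝ) 1 := ⟨hr0.le, hr.2⟩
  have hsub := sphere_subset_ball_one hr'
  have hc := hFd.continuousOn.mono hsub
  have hct := htd.continuousOn.mono hsub
  have hI1 := circleIntegrable_norm_rpow hq0 hct
  have hI2 := circleIntegrable_norm_rpow hq0 hc
  have hI3 : CircleIntegrable (fun z => ‖F (t * z) - F z‖ ^ q) 0 r := circleIntegrable_norm_rpow hq0 (hct.sub hc)
  have hI4 : CircleIntegrable (fun z => ‖(F (t * z) + F z) / 2‖ ^ q) 0 r :=
    circleIntegrable_norm_rpow hq0 ((hct.add hc).div_const 2)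
  have hmono : circleAverage (fun z => ‖(F (t * z) + F z) / 2‖ ^ q) 0 ρ ≤
      circleAverage (fun z => ‖(F (t * z) + F z) / 2‖ ^ q) 0 r := circleAverage_norm_rpow_mono hq.le hρ.1.le hρr.le
    (diffContOnCl_of_lt_one ((htd.add hFd).div_const 2) hr.2)
  have hA := htmean r ⟨hr0, hr.2⟩
  have hB : circleAverage (fun z => ‖F z‖ ^ q) 0 r ≤ N := circleAverage_le hp f hr'
  set c := ε ^ q / (4 * (N + 1)) with hcdef
  have hint : circleAverage (fun z => ‖F (t * z) - F z‖ ^ q) 0 r ≤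
      circleAverage (((c + K / 2) • fun z => ‖F (t * z)‖ ^ q) + ((c + K / 2) • fun z => ‖F z‖ ^ q)
        - (K • fun z => ‖(F (t * z) + F z) / 2‖ ^ q)) 0 r := by
    refine Real.circleAverage_mono hI3 ((hI1.const_smul.add hI2.const_smul).sub hI4.const_smul)
      fun z _ => (hK (F (t * z)) (F z)).trans (le_of_eq ?_)
    simp only [Pi.add_apply, Pi.sub_apply, Pi.smul_apply, smul_eq_mul]
    ring
  rw [Real.circleAverage_sub (hI1.const_smul.add hI2.const_smul) hI4.const_smul,
    Real.circleAverage_add hI1.const_smul hI2.const_smul, Real.circleAverage_smul,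
    Real.circleAverage_smul, Real.circleAverage_smul] at hint
  simp only [smul_eq_mul] at hint
  have hc0 : 0 ≤ c := by positivity
  set A := circleAverage (fun z => ‖F (t * z)‖ ^ q) 0 r
  set B := circleAverage (fun z => ‖F z‖ ^ q) 0 r
  set D := circleAverage (fun z => ‖(F (t * z) + F z) / 2‖ ^ q) 0 r
  have hD : N - ε ^ q / (2 * (K + 1)) ≤ D := ht1.le.trans hmono
  have hA' : (c + K / 2) * A ≤ (c + K / 2) * N := mul_le_mul_of_nonneg_left hA (by positivity)
  have hB' : (c + K / 2) * B ≤ (c + K / 2) * N := mul_le_mul_of_nonneg_left hB (by positivity)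
  have hD' := mul_le_mul_of_nonneg_left hD hK0
  have e1 : 2 * c * N ≤ ε ^ q / 2 := by
    rw [hcdef, ← sub_nonneg]
    have : ε ^ q / 2 - 2 * (ε ^ q / (4 * (N + 1))) * N = ε ^ q / (2 * (N + 1)) := by
      field_simp; ring
    rw [this]; positivity
  have e2 : K * (ε ^ q / (2 * (K + 1))) ≤ ε ^ q / 2 := by
    rw [← sub_nonneg]
    have : ε ^ q / 2 - K * (ε ^ q / (2 * (K + 1))) = ε ^ q / (2 * (K + 1)) := by
      field_simp; ring
    rw [this]; positivity
  linarith

theorem circleAverage_norm_rpow_le_of_bound {F : ℂ → ℂ} (hF : ContinuousOn F (ball 0 1)) {q M r : ℝ}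
    (hq : 0 ≤ q) (hr : r ∈ Ioo (0 : ℝ) 1) (hM : ∀ z ∈ ball (0 : ℂ) 1, ‖F z‖ ≤ M) :
    circleAverage (fun z => ‖F z‖ ^ q) 0 r ≤ M ^ q := by
  have hsub := sphere_subset_ball_one ⟨hr.1.le, hr.2⟩
  exact Real.circleAverage_mono_on_of_le_circle (circleIntegrable_norm_rpow hq (hF.mono hsub))
    fun z hz => Real.rpow_le_rpow (norm_nonneg _) (hM z (hsub hz)) hq

/-- A bounded holomorphic function as an element of `H^p`. -/
def ofBounded (hp : p ≠ ⊤) (F : ℂ → ℂ) (hF : DifferentiableOn ℂ F (ball 0 1)) (M : ℝ)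
    (hM : ∀ z ∈ ball (0 : ℂ) 1, ‖F z‖ ≤ M) : HardySpace p :=
  ofFun hp F hF M ((norm_nonneg _).trans (hM 0 (by simp))) fun _ hr =>
    circleAverage_norm_rpow_le_of_bound hF.continuousOn ENNReal.toReal_nonneg hr hM

@[simp] theorem ofBounded_apply (hp : p ≠ ⊤) (F : ℂ → ℂ) (hF : DifferentiableOn ℂ F (ball 0 1))
    (M : ℝ) (hM) (z : 𝔻) : ofBounded (p := p) hp F hF M hM z = F z := rfl

theorem norm_le_of_bound (hp : p ≠ ⊤) (f : HardySpace p) {M : ℝ}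
    (hM : ∀ z : 𝔻, ‖f z‖ ≤ M) : ‖f‖ ≤ M := by
  refine norm_le_of_circleAverage_le hp f zero_lt_one ((norm_nonneg _).trans (hM 0)) fun r hr => ?_
  refine circleAverage_norm_rpow_le_of_bound f.2.1.continuousOn ENNReal.toReal_nonneg hr
    fun z hz => ?_
  rw [discExtend_of_norm_lt f.1 (mem_ball_zero_iff.1 hz)]
  exact hM _

theorem exists_polynomial_bound (P : Polynomial ℂ) :
    ∃ M, ∀ z ∈ ball (0 : ℂ) 1, ‖P.eval z‖ ≤ M := by
  obtain ⟨M, hM⟩ := (isCompact_closedBall (0 : ℂ) 1).exists_bound_of_continuousOn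
    (f := fun z => P.eval z) P.continuous.continuousOn
  exact ⟨M, fun z hz => hM z (ball_subset_closedBall hz)⟩

/-- Polynomials as elements of `H^p`. -/
def ofPolynomial (hp : p ≠ ⊤) : Polynomial ℂ →ₗ[ℂ] HardySpace p where
  toFun P := ofBounded hp (fun z => P.eval z) P.differentiable.differentiableOn _
    (exists_polynomial_bound P).choose_spec
  map_add' P Q := by ext z; simp
  map_smul' c P := by ext z; simp

@[simp] theorem ofPolynomial_apply (hp : p ≠ ⊤) (P : Polynomial ℂ) (z : 𝔻) :
    ofPolynomial (p := p) hp P z = P.eval (z : ℂ) := rfl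

theorem exists_polynomial_near (hpp : 1 < p) (hp : p ≠ ⊤) (f : HardySpace p) {ε : ℝ}
    (hε : 0 < ε) : ∃ P : Polynomial ℂ, ‖f - ofPolynomial hp P‖ ≤ ε := by
  obtain ⟨t, ht, g, hg, hgf⟩ := exists_dilation_near hpp hp f (half_pos hε)
  obtain ⟨s, hts, hs1⟩ := exists_between ht.2
  have hs0 : 0 < s := ht.1.trans hts
  lift s to ℝ≥0 using hs0.le
  lift t to ℝ≥0 using ht.1.le
  have hps := (f.2.1.mono (closedBall_subset_ball hs1)).hasFPowerSeriesOnBall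
    (by exact_mod_cast hs0)
  have hunif := hps.tendstoUniformlyOn (r' := t) (by exact_mod_cast hts)
  obtain ⟨n, hn⟩ := ((Metric.tendstoUniformlyOn_iff.1 hunif) (ε / 2) (half_pos hε)).exists
  set ps := cauchyPowerSeries (discExtend f.1) 0 s
  -- the dilation of the partial sum of the Taylor series
  set P : Polynomial ℂ := ∑ k ∈ Finset.range n,
    Polynomial.monomial k (((t : ℝ) : ℂ) ^ k * ps.coeff k) with hP
  have hPe : ∀ z : ℂ, P.eval z = ps.partialSum n ((t : ℝ) * z) := fun z => by
    rw [hP, Polynomial.eval_finsetSum, FormalMultilinearSeries.partialSum]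
    refine Finset.sum_congr rfl fun k _ => ?_
    rw [Polynomial.eval_monomial, FormalMultilinearSeries.apply_eq_pow_smul_coeff, smul_eq_mul,
      mul_pow]
    ring
  refine ⟨P, ?_⟩
  have h1 : ‖g - ofPolynomial hp P‖ ≤ ε / 2 := by
    refine norm_le_of_bound hp _ fun z => ?_
    rw [coe_sub, hg, ofPolynomial_apply, hPe, ← dist_eq_norm]
    have hz : ((t : ℝ) : ℂ) * z ∈ ball (0 : ℂ) t := by
      rw [mem_ball_zero_iff, norm_mul, Complex.norm_of_nonneg ht.1.le]
      nlinarith [z.norm_lt_one, ht.1]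
    simpa using (hn _ hz).le
  calc ‖f - ofPolynomial hp P‖ = ‖(g - ofPolynomial hp P) - (g - f)‖ := by congr 1; abel
    _ ≤ ‖g - ofPolynomial hp P‖ + ‖g - f‖ := norm_sub_le _ _
    _ ≤ ε := by linarith

/-- The powers of `z - β` span a dense subspace of `H^p`, `1 < p < ∞`. -/
theorem eq_zero_of_forall_pow (hpp : 1 < p) (hp : p ≠ ⊤) (Λ : StrongDual ℂ (HardySpace p)) (β : ℂ)
    (h : ∀ n : ℕ, Λ (ofPolynomial hp ((Polynomial.X - Polynomial.C β) ^ n)) = 0) : Λ = 0 := by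
  have hpoly : ∀ P : Polynomial ℂ, Λ (ofPolynomial hp P) = 0 := by
    intro P
    rw [← Polynomial.sum_taylor_eq P β, Polynomial.sum_def, map_sum, map_sum]
    refine Finset.sum_eq_zero fun n _ => ?_
    rw [← Polynomial.smul_eq_C_mul, map_smul, map_smul, h, smul_zero]
  ext f
  refine norm_le_zero_iff.1 (le_of_forall_pos_le_add fun ε hε => ?_)
  obtain ⟨P, hP⟩ := exists_polynomial_near hpp hp f (ε := ε / (‖Λ‖ + 1)) (by positivity)
  calc ‖Λ f‖ = ‖Λ (f - ofPolynomial hp P)‖ := by rw [map_sub, hpoly, sub_zero]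
    _ ≤ ‖Λ‖ * (ε / (‖Λ‖ + 1)) := (Λ.le_opNorm _).trans (by gcongr)
    _ ≤ 0 + ε := by
      rw [zero_add, mul_div_assoc', div_le_iff₀ (by positivity)]
      nlinarith [norm_nonneg Λ]

end HardySpace

/-! ### The half-plane coordinate attached to two boundary points -/

/-- An ordered pair of distinct points of the unit circle. -/
structure BoundaryPair where
  /-- the zero of the half-plane coordinate -/
  α : ℂ
  /-- the pole of the half-plane coordinate -/
  β : ℂ
  norm_α : ‖α‖ = 1
  norm_β : ‖β‖ = 1
  ne : α ≠ β

namespace BoundaryPair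

variable (b : BoundaryPair)

/-- The constant that rotates the image of the disc under `(α - z) / (z - β)` to the right
half-plane. -/
def κ : ℂ := 1 - conj b.α * b.β

/-- The Möbius coordinate `v(z) = κ (α - z) / (z - β)`, which maps the disc onto the right
half-plane. -/
def coord (z : ℂ) : ℂ := b.κ * (b.α - z) / (z - b.β)

/-- The inverse of `coord`. -/
def invCoord (v : ℂ) : ℂ := (b.α * b.κ + b.β * v) / (b.κ + v)

theorem α_mul_κ : b.α * b.κ = b.α - b.β := by
  have h : b.α * conj b.α = 1 := by
    rw [Complex.mul_conj, Complex.normSq_eq_norm_sq, b.norm_α]; simp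
  rw [κ]
  linear_combination (-b.β) * h

theorem norm_κ : ‖b.κ‖ = ‖b.α - b.β‖ := by
  rw [← b.α_mul_κ, norm_mul, b.norm_α, one_mul]

theorem sub_ne : b.α - b.β ≠ 0 := sub_ne_zero.2 b.ne

theorem κ_ne : b.κ ≠ 0 := by
  rw [← norm_ne_zero_iff, b.norm_κ]
  exact norm_ne_zero_iff.2 b.sub_ne

theorem re_sq_α : b.α.re * b.α.re + b.α.im * b.α.im = 1 := by
  rw [← Complex.normSq_apply, Complex.normSq_eq_norm_sq, b.norm_α, one_pow]

theorem re_sq_β : b.β.re * b.β.re + b.β.im * b.β.im = 1 := by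
  rw [← Complex.normSq_apply, Complex.normSq_eq_norm_sq, b.norm_β, one_pow]

theorem two_mul_re_κ : 2 * b.κ.re = ‖b.α - b.β‖ ^ 2 := by
  rw [← Complex.normSq_eq_norm_sq, Complex.normSq_apply, κ]
  simp only [sub_re, sub_im, one_re, mul_re, conj_re, conj_im]
  linear_combination (-1 : ℝ) * b.re_sq_α - b.re_sq_β

theorem re_κ_pos : 0 < b.κ.re := by
  have h := b.two_mul_re_κ
  have : 0 < ‖b.α - b.β‖ ^ 2 := by
    have := norm_pos_iff.2 b.sub_ne
    positivity
  linarith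

theorem sub_β_ne {z : ℂ} (hz : ‖z‖ < 1) : z - b.β ≠ 0 := by
  intro h
  rw [sub_eq_zero.1 h, b.norm_β] at hz
  exact lt_irrefl _ hz

theorem re_coord_mul {z : ℂ} (hz : z ≠ b.β) :
    (b.coord z).re * ‖z - b.β‖ ^ 2 = b.κ.re * (1 - ‖z‖ ^ 2) := by
  have hz' : z - b.β ≠ 0 := sub_ne_zero.2 hz
  have h1 : b.coord z * ((‖z - b.β‖ ^ 2 : ℝ) : ℂ) = b.κ * (b.α - z) * conj (z - b.β) := by
    rw [← Complex.normSq_eq_norm_sq, ← Complex.mul_conj, coord]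
    field_simp
  have h2 := congrArg re h1
  rw [Complex.re_mul_ofReal] at h2
  rw [h2, ← Complex.normSq_eq_norm_sq, Complex.normSq_apply, κ]
  simp only [mul_re, mul_im, sub_re, sub_im, one_re, one_im, conj_re, conj_im]
  have hA := b.re_sq_α
  have hB := b.re_sq_β
  linear_combination (-(b.β.re * z.re) - b.β.im * z.im + b.β.re * b.β.re + b.β.im * b.β.im) * hA +
    (1 - b.α.re * z.re - b.α.im * z.im) * hB

theorem re_coord_pos {z : ℂ} (hz : ‖z‖ < 1) : 0 < (b.coord z).re := by
  have hne := b.sub_β_ne hz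
  have h := b.re_coord_mul (sub_ne_zero.1 hne)
  have h1 : 0 < ‖z - b.β‖ ^ 2 := by
    have := norm_pos_iff.2 hne
    positivity
  have h2 : 0 < b.κ.re * (1 - ‖z‖ ^ 2) :=
    mul_pos b.re_κ_pos (by nlinarith [norm_nonneg z])
  rw [← h] at h2
  exact pos_of_mul_pos_left h2 h1.le

theorem coord_ne_zero {z : ℂ} (hz : ‖z‖ < 1) : b.coord z ≠ 0 := by
  intro h
  have := b.re_coord_pos hz
  rw [h] at this
  simp at this

theorem coord_mem_slitPlane {z : ℂ} (hz : ‖z‖ < 1) : b.coord z ∈ slitPlane :=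
  Or.inl (b.re_coord_pos hz)

theorem κ_add_ne {v : ℂ} (hv : 0 < v.re) : b.κ + v ≠ 0 := by
  intro h
  have := congrArg re h
  rw [add_re, zero_re] at this
  linarith [b.re_κ_pos]

theorem invCoord_sub_β {v : ℂ} (hv : 0 < v.re) :
    b.invCoord v - b.β = (b.α - b.β) * b.κ / (b.κ + v) := by
  have := b.κ_add_ne hv
  rw [invCoord]
  field_simp
  ring

theorem α_sub_invCoord {v : ℂ} (hv : 0 < v.re) :
    b.α - b.invCoord v = (b.α - b.β) * v / (b.κ + v) := by
  have := b.κ_add_ne hv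
  rw [invCoord]
  field_simp
  ring

theorem coord_invCoord {v : ℂ} (hv : 0 < v.re) : b.coord (b.invCoord v) = v := by
  have h1 := b.κ_add_ne hv
  have h2 := b.sub_ne
  have h3 := b.κ_ne
  rw [coord, b.invCoord_sub_β hv, b.α_sub_invCoord hv]
  field_simp

theorem norm_invCoord_lt {v : ℂ} (hv : 0 < v.re) : ‖b.invCoord v‖ < 1 := by
  have h1 : b.invCoord v - b.β ≠ 0 := by
    rw [b.invCoord_sub_β hv]
    exact div_ne_zero (mul_ne_zero b.sub_ne b.κ_ne) (b.κ_add_ne hv)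
  have h := b.re_coord_mul (sub_ne_zero.1 h1)
  rw [b.coord_invCoord hv] at h
  have h2 : 0 < v.re * ‖b.invCoord v - b.β‖ ^ 2 := by
    have := norm_pos_iff.2 h1
    positivity
  rw [h] at h2
  have h3 := pos_of_mul_pos_right h2 b.re_κ_pos.le
  nlinarith [norm_nonneg (b.invCoord v)]

theorem invCoord_coord {z : ℂ} (hz : ‖z‖ < 1) : b.invCoord (b.coord z) = z := by
  have h1 := b.sub_β_ne hz
  have h2 := b.sub_ne
  have h3 := b.κ_ne
  have h4 : b.κ + b.coord z = b.κ * (b.α - b.β) / (z - b.β) := by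
    rw [coord]; field_simp; ring
  rw [invCoord, h4, coord]
  field_simp
  ring

theorem coord_injOn {z w : ℂ} (hz : ‖z‖ < 1) (hw : ‖w‖ < 1) (h : b.coord z = b.coord w) :
    z = w := by
  rw [← b.invCoord_coord hz, h, b.invCoord_coord hw]

theorem differentiableOn_coord : DifferentiableOn ℂ b.coord (ball 0 1) := by
  intro z hz
  have := b.sub_β_ne (mem_ball_zero_iff.1 hz)
  unfold coord
  fun_prop (disch := assumption)

theorem differentiableOn_log_coord :
    DifferentiableOn ℂ (fun z => Complex.log (b.coord z)) (ball 0 1) :=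
  b.differentiableOn_coord.clog fun _ hz => b.coord_mem_slitPlane (mem_ball_zero_iff.1 hz)

/-- The one-parameter group of hyperbolic automorphisms, `v ∘ flow x = eˣ v`. -/
def flow (x : ℝ) (z : 𝔻) : 𝔻 :=
  UnitDisc.mk (b.invCoord ((Real.exp x : ℝ) * b.coord z)) (b.norm_invCoord_lt (by
    rw [Complex.re_ofReal_mul]
    exact mul_pos (Real.exp_pos x) (b.re_coord_pos z.norm_lt_one)))

theorem re_exp_mul_coord_pos (x : ℝ) {z : ℂ} (hz : ‖z‖ < 1) :
    0 < (((Real.exp x : ℝ) : ℂ) * b.coord z).re := by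
  rw [Complex.re_ofReal_mul]
  exact mul_pos (Real.exp_pos x) (b.re_coord_pos hz)

theorem coord_flow (x : ℝ) (z : 𝔻) : b.coord (b.flow x z) = (Real.exp x : ℝ) * b.coord z :=
  b.coord_invCoord (b.re_exp_mul_coord_pos x z.norm_lt_one)

/-- An automorphism acting on the half-plane coordinate by a positive factor belongs to the flow. -/
theorem eq_flow {φ : 𝔻 → 𝔻} {x : ℝ} (h : ∀ z : 𝔻, b.coord (φ z) = (Real.exp x : ℝ) * b.coord z) :
    φ = b.flow x := by
  funext z
  refine UnitDisc.coe_injective (b.coord_injOn (φ z).norm_lt_one (b.flow x z).norm_lt_one ?_)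
  rw [h, b.coord_flow]

theorem flow_flow (x y : ℝ) (z : 𝔻) : b.flow x (b.flow y z) = b.flow (x + y) z := by
  refine UnitDisc.coe_injective (b.coord_injOn (b.flow x _).norm_lt_one
    (b.flow (x + y) z).norm_lt_one ?_)
  rw [b.coord_flow, b.coord_flow, b.coord_flow, Real.exp_add]
  push_cast
  ring

theorem flow_zero (z : 𝔻) : b.flow 0 z = z := by
  refine UnitDisc.coe_injective (b.coord_injOn (b.flow 0 _).norm_lt_one z.norm_lt_one ?_)
  rw [b.coord_flow, Real.exp_zero, ofReal_one, one_mul]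

theorem isHolomorphic_flow (x : ℝ) : IsHolomorphic fun z => (b.flow x z : ℂ) := by
  refine DifferentiableOn.congr
    (f := fun z => b.invCoord (((Real.exp x : ℝ) : ℂ) * b.coord z)) ?_ fun z hz => ?_
  · intro z hz
    have h1 := b.κ_add_ne (b.re_exp_mul_coord_pos x (mem_ball_zero_iff.1 hz))
    have h2 := b.differentiableOn_coord z hz
    unfold invCoord
    fun_prop (disch := assumption)
  · rw [discExtend_of_norm_lt _ (mem_ball_zero_iff.1 hz)]
    rfl

theorem one_sub_norm_flow_zero (x : ℝ) :
    ‖b.α - b.β‖ ^ 2 * (4 * Real.exp |x|)⁻¹ ≤ 1 - ‖(b.flow x 0 : ℂ)‖ ^ 2 := by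
  set ψ : ℂ := ((b.flow x 0 : 𝔻) : ℂ) with hψ
  set τ := Real.exp x with hτ
  have hτ0 : 0 < τ := Real.exp_pos x
  have hv := b.re_exp_mul_coord_pos x (z := 0) (by simp)
  have h0 : (b.coord 0).re = b.κ.re := by
    have h := b.re_coord_mul (z := 0) (by
      intro h
      have := b.norm_β
      rw [← h] at this
      simp at this)
    simpa [b.norm_β] using h
  have hn0 : ‖b.coord 0‖ = ‖b.κ‖ := by
    simp [coord, b.norm_β, b.norm_α]
  have hψv : ψ = b.invCoord ((τ : ℂ) * b.coord 0) := rfl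
  have h1 : ψ - b.β = (b.α - b.β) * b.κ / (b.κ + (τ : ℂ) * b.coord 0) := by
    rw [hψv, b.invCoord_sub_β hv]
  have h2 := b.re_coord_mul (z := ψ) (by
    intro h
    have h3 := (b.flow x 0).norm_lt_one
    rw [← hψ, h, b.norm_β] at h3
    exact lt_irrefl _ h3)
  rw [hψ, b.coord_flow, ← hψ, Complex.re_ofReal_mul, UnitDisc.coe_zero, h0] at h2
  have h3 : 1 - ‖ψ‖ ^ 2 = τ * ‖ψ - b.β‖ ^ 2 := by
    have := b.re_κ_pos.ne'
    have h4 : b.κ.re * (1 - ‖ψ‖ ^ 2) = b.κ.re * (τ * ‖ψ - b.β‖ ^ 2) := by rw [← h2]; ring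
    exact mul_left_cancel₀ this h4
  have hκ : 0 < ‖b.κ‖ := norm_pos_iff.2 b.κ_ne
  have h5 : ‖b.κ + (τ : ℂ) * b.coord 0‖ ≤ ‖b.κ‖ * (1 + τ) := by
    refine (norm_add_le _ _).trans (le_of_eq ?_)
    rw [norm_mul, hn0, Complex.norm_of_nonneg hτ0.le]
    ring
  have h6 : 0 < ‖b.κ + (τ : ℂ) * b.coord 0‖ := norm_pos_iff.2 (b.κ_add_ne hv)
  have h7 : ‖b.α - b.β‖ / (1 + τ) ≤ ‖ψ - b.β‖ := by
    rw [h1, norm_div, norm_mul, div_le_div_iff₀ (by positivity) h6]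
    calc ‖b.α - b.β‖ * ‖b.κ + (τ : ℂ) * b.coord 0‖
        ≤ ‖b.α - b.β‖ * (‖b.κ‖ * (1 + τ)) := by gcongr
      _ = _ := by ring
  have h8 : (1 + τ) ^ 2 ≤ τ * (4 * Real.exp |x|) := by
    rcases le_total 0 x with hx | hx
    · rw [abs_of_nonneg hx, ← hτ]
      have : 1 ≤ τ := Real.one_le_exp hx
      nlinarith
    · rw [abs_of_nonpos hx]
      have : τ ≤ 1 := Real.exp_le_one_iff.2 hx
      have h9 : τ * Real.exp (-x) = 1 := by rw [hτ, ← Real.exp_add]; simp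
      nlinarith
  rw [h3]
  calc ‖b.α - b.β‖ ^ 2 * (4 * Real.exp |x|)⁻¹
      ≤ τ * (‖b.α - b.β‖ / (1 + τ)) ^ 2 := by
        rw [div_pow, mul_div_assoc', ← div_eq_mul_inv,
          div_le_div_iff₀ (by positivity) (by positivity)]
        calc ‖b.α - b.β‖ ^ 2 * (1 + τ) ^ 2 ≤ ‖b.α - b.β‖ ^ 2 * (τ * (4 * Real.exp |x|)) := by gcongr
          _ = _ := by ring
    _ ≤ τ * ‖ψ - b.β‖ ^ 2 := by gcongr

end BoundaryPair

/-- A hyperbolic automorphism acts on the half-plane coordinate attached to its fixed points as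
multiplication by a positive number different from `1`. -/
theorem IsHyperbolicAutomorphism.exists_eq_flow {φ : 𝔻 → 𝔻} (hφ : IsHyperbolicAutomorphism φ) :
    ∃ (b : BoundaryPair) (x : ℝ), x ≠ 0 ∧ φ = b.flow x := by
  obtain ⟨-, a, b, c, d, hdet, hφ, ζ, ξ, hζ, hξ, hne, hfix⟩ := hφ
  have hζm : c * ζ + d ≠ 0 ∧ (a * ζ + b) / (c * ζ + d) = ζ := by
    have : ζ ∈ ({ζ, ξ} : Set ℂ) := by simp
    rwa [← hfix] at this
  have hξm : c * ξ + d ≠ 0 ∧ (a * ξ + b) / (c * ξ + d) = ξ := by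
    have : ξ ∈ ({ζ, ξ} : Set ℂ) := by simp
    rwa [← hfix] at this
  have h1 : a * ζ + b = ζ * (c * ζ + d) := (div_eq_iff hζm.1).1 hζm.2
  have h2 : a * ξ + b = ξ * (c * ξ + d) := (div_eq_iff hξm.1).1 hξm.2
  have hA : a - ζ * c ≠ 0 := by
    intro h
    apply hdet
    have hb : b = ζ * d := by linear_combination h1 - ζ * h
    rw [hb, sub_eq_zero.1 h]; ring
  have hB : a - ξ * c ≠ 0 := by
    intro h
    apply hdet
    have hb : b = ξ * d := by linear_combination h2 - ξ * h
    rw [hb, sub_eq_zero.1 h]; ring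
  let B : BoundaryPair := ⟨ζ, ξ, hζ, hξ, hne⟩
  set k := (a - ζ * c) / (a - ξ * c) with hk
  have hcoord : ∀ z : 𝔻, B.coord (φ z) = k * B.coord z := by
    intro z
    have hz1 := B.sub_β_ne z.norm_lt_one
    have hcd := (hφ z).1
    have e1 : (φ z : ℂ) - ξ = (a - ξ * c) * (z - ξ) / (c * z + d) := by
      rw [(hφ z).2, eq_div_iff hcd, sub_mul, div_mul_cancel₀ _ hcd]
      linear_combination h2
    have e2 : ζ - (φ z : ℂ) = (a - ζ * c) * (ζ - z) / (c * z + d) := by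
      rw [(hφ z).2, eq_div_iff hcd, sub_mul, div_mul_cancel₀ _ hcd]
      linear_combination -h1
    change B.κ * (ζ - (φ z : ℂ)) / ((φ z : ℂ) - ξ) = k * (B.κ * (ζ - z) / (z - ξ))
    have hz2 : (z : ℂ) - ξ ≠ 0 := hz1
    rw [e1, e2, hk]
    field_simp
  -- multiplication by `k` preserves the right half-plane, hence `k > 0`
  have hkpos : ∀ y : ℝ, 0 < k.re - k.im * y := by
    intro y
    have hv : 0 < ((1 : ℂ) + y * I).re := by simp
    have h3 := hcoord (UnitDisc.mk _ (B.norm_invCoord_lt hv))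
    rw [UnitDisc.coe_mk, B.coord_invCoord hv] at h3
    have h4 := B.re_coord_pos (φ (UnitDisc.mk _ (B.norm_invCoord_lt hv))).norm_lt_one
    rw [h3] at h4
    simpa [mul_re] using h4
  have hre : 0 < k.re := by simpa using hkpos 0
  have him : k.im = 0 := by
    by_contra h
    have := hkpos (k.re / k.im)
    rw [mul_div_cancel₀ _ h, sub_self] at this
    exact lt_irrefl _ this
  have hkr : k = ((Real.exp (Real.log k.re) : ℝ) : ℂ) := by
    rw [Real.exp_log hre]
    exact Complex.ext (by simp) (by simpa using him)
  refine ⟨B, Real.log k.re, fun h0 => ?_, B.eq_flow fun z => by rw [hcoord, ← hkr]⟩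
  have hk1 : k = 1 := by rw [hkr, h0]; simp
  have hc : c = 0 := by
    rw [hk, div_eq_one_iff_eq hB] at hk1
    have : (ξ - ζ) * c = 0 := by linear_combination hk1
    exact (mul_eq_zero.1 this).resolve_left (sub_ne_zero.2 hne.symm)
  subst hc
  have had : a = d := by
    have : (ζ - ξ) * (a - d) = 0 := by linear_combination h1 - h2
    exact sub_eq_zero.1 ((mul_eq_zero.1 this).resolve_left (sub_ne_zero.2 hne))
  have hb : b = 0 := by linear_combination h1 - ζ * had
  have h0m : (0 : ℂ) ∈ ({ζ, ξ} : Set ℂ) := by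
    rw [← hfix]
    refine ⟨?_, by simp [hb]⟩
    have := hζm.1
    simpa using this
  rcases h0m with h | h
  · rw [← h] at hζ; simp at hζ
  · rw [mem_singleton_iff] at h
    rw [← h] at hξ; simp at hξ

/-! ### Composition operators -/

namespace HardySpace

theorem discExtend_mem_ball (ψ : 𝔻 → 𝔻) {z : ℂ} (hz : z ∈ ball (0 : ℂ) 1) :
    discExtend (fun z => (ψ z : ℂ)) z ∈ ball (0 : ℂ) 1 := by
  rw [discExtend_of_norm_lt _ (mem_ball_zero_iff.1 hz), mem_ball_zero_iff]
  exact UnitDisc.norm_lt_one _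

theorem circleAverage_comp_le (hp : p ≠ ⊤) {ψ : 𝔻 → 𝔻} (hψ : IsHolomorphic fun z => (ψ z : ℂ))
    (f : HardySpace p) {r : ℝ} (hr : r ∈ Ioo (0 : ℝ) 1) :
    circleAverage (fun z => ‖discExtend f.1 (discExtend (fun z => (ψ z : ℂ)) z)‖ ^ p.toReal) 0 r ≤
      (1 + ‖(ψ 0 : ℂ)‖) / (1 - ‖(ψ 0 : ℂ)‖) * ‖f‖ ^ p.toReal := by
  have hq := one_le_toReal hp1.out hp
  set Ψ := discExtend fun z => (ψ z : ℂ) with hΨ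
  have h0 : Ψ 0 = ψ 0 := discExtend_coe (fun z => (ψ z : ℂ)) 0
  have hs := (ψ 0).norm_lt_one
  have hcb : closedBall (0 : ℂ) r ⊆ ball 0 1 := closedBall_subset_ball hr.2
  have hψr : DifferentiableOn ℂ Ψ (closedBall 0 r) := hψ.mono hcb
  obtain ⟨z₀, hz₀, hmax⟩ := (isCompact_closedBall (0 : ℂ) r).exists_isMaxOn
    ⟨0, by simp [hr.1.le]⟩ hψr.continuousOn.norm
  have hm1 : ‖Ψ z₀‖ < 1 := mem_ball_zero_iff.1 (discExtend_mem_ball ψ (hcb hz₀))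
  have hev : ∀ᶠ ρ : ℝ in 𝓝[<] 1, ρ ∈ Ioo (max ‖Ψ z₀‖ ‖(ψ 0 : ℂ)‖) 1 :=
    Ioo_mem_nhdsLT (max_lt hm1 hs)
  have hlim : Tendsto (fun ρ : ℝ => (ρ + ‖(ψ 0 : ℂ)‖) / (ρ - ‖(ψ 0 : ℂ)‖) * ‖f‖ ^ p.toReal)
      (𝓝[<] 1) (𝓝 ((1 + ‖(ψ 0 : ℂ)‖) / (1 - ‖(ψ 0 : ℂ)‖) * ‖f‖ ^ p.toReal)) := by
    have : ContinuousAt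
        (fun ρ : ℝ => (ρ + ‖(ψ 0 : ℂ)‖) / (ρ - ‖(ψ 0 : ℂ)‖) * ‖f‖ ^ p.toReal) 1 := by
      have h : (1 : ℝ) - ‖(ψ 0 : ℂ)‖ ≠ 0 := by linarith
      fun_prop (disch := assumption)
    exact this.tendsto.mono_left nhdsWithin_le_nhds
  refine ge_of_tendsto hlim ?_
  filter_upwards [hev] with ρ hρ
  have hρ0 : 0 < ρ := (norm_nonneg _).trans_lt ((le_max_left _ _).trans_lt hρ.1)
  have h1 := circleAverage_norm_rpow_comp_le hq hr.1 (ρ := ρ)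
    (diffContOnCl_of_lt_one f.2.1 hρ.2) hψr
    (fun z hz => mem_ball_zero_iff.2 ((hmax hz).trans_lt ((le_max_left _ _).trans_lt hρ.1)))
  rw [h0] at h1
  refine h1.trans (mul_le_mul_of_nonneg_left (circleAverage_le hp f ⟨hρ0.le, hρ.2⟩) ?_)
  have := (le_max_right ‖Ψ z₀‖ ‖(ψ 0 : ℂ)‖).trans_lt hρ.1
  exact div_nonneg (by positivity) (by linarith)

/-- The composition operator with a holomorphic self-map of the disc. -/
def compLM (hp : p ≠ ⊤) (ψ : 𝔻 → 𝔻) (hψ : IsHolomorphic fun z => (ψ z : ℂ)) :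
    HardySpace p →ₗ[ℂ] HardySpace p where
  toFun f := ⟨fun z => f (ψ z), by
    have hq := one_le_toReal hp1.out hp
    have hs := (ψ 0).norm_lt_one
    have hco : EqOn (discExtend fun z => f (ψ z))
        (discExtend f.1 ∘ discExtend fun z => (ψ z : ℂ)) (ball 0 1) := fun z hz => by
      rw [Function.comp_apply, discExtend_of_norm_lt _ (mem_ball_zero_iff.1 hz),
        discExtend_of_norm_lt _ (mem_ball_zero_iff.1 hz), discExtend_coe]
    have hhol : IsHolomorphic fun z => f (ψ z) :=
      (f.2.1.comp hψ fun z hz => discExtend_mem_ball ψ hz).congr hco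
    have hK : 0 ≤ (1 + ‖(ψ 0 : ℂ)‖) / (1 - ‖(ψ 0 : ℂ)‖) :=
      div_nonneg (by positivity) (by linarith)
    refine ⟨hhol, (hardyENorm_le hp1.out hp hhol zero_lt_one
      (M := ((1 + ‖(ψ 0 : ℂ)‖) / (1 - ‖(ψ 0 : ℂ)‖)) ^ (1 / p.toReal) * ‖f‖) (by positivity)
      fun r hr => ?_).trans_lt ENNReal.ofReal_lt_top⟩
    rw [Real.mul_rpow (by positivity) (norm_nonneg f), ← Real.rpow_mul hK,
      one_div_mul_cancel (by linarith), Real.rpow_one]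
    refine le_of_eq_of_le (Real.circleAverage_congr_sphere fun z hz => ?_)
      (circleAverage_comp_le hp hψ f hr)
    simp only [hco (sphere_subset_ball_one ⟨hr.1.le, hr.2⟩ hz), Function.comp_apply]⟩
  map_add' f g := rfl
  map_smul' c f := rfl

theorem norm_compLM_le (hp : p ≠ ⊤) (ψ : 𝔻 → 𝔻) (hψ : IsHolomorphic fun z => (ψ z : ℂ))
    (f : HardySpace p) : ‖compLM hp ψ hψ f‖ ≤
      ((1 + ‖(ψ 0 : ℂ)‖) / (1 - ‖(ψ 0 : ℂ)‖)) ^ (1 / p.toReal) * ‖f‖ := by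
  have hq := one_le_toReal hp1.out hp
  have hs := (ψ 0).norm_lt_one
  have hK : 0 ≤ (1 + ‖(ψ 0 : ℂ)‖) / (1 - ‖(ψ 0 : ℂ)‖) :=
    div_nonneg (by positivity) (by linarith)
  refine norm_le_of_eqOn hp _ (F := discExtend f.1 ∘ discExtend fun z => (ψ z : ℂ))
    (fun z => ?_) zero_lt_one (by positivity) fun r hr => ?_
  · rw [Function.comp_apply, discExtend_coe, discExtend_coe]
    rfl
  · rw [max_self] at hr
    rw [Real.mul_rpow (by positivity) (norm_nonneg f), ← Real.rpow_mul hK,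
      one_div_mul_cancel (by linarith), Real.rpow_one]
    exact circleAverage_comp_le hp hψ f hr

/-- The bounded composition operator with a holomorphic self-map of the disc. -/
def comp (hp : p ≠ ⊤) (ψ : 𝔻 → 𝔻) (hψ : IsHolomorphic fun z => (ψ z : ℂ)) :
    HardySpace p →L[ℂ] HardySpace p :=
  (compLM hp ψ hψ).mkContinuous _ (norm_compLM_le hp ψ hψ)

@[simp] theorem comp_apply (hp : p ≠ ⊤) (ψ : 𝔻 → 𝔻) (hψ : IsHolomorphic fun z => (ψ z : ℂ))
    (f : HardySpace p) (z : 𝔻) : comp hp ψ hψ f z = f (ψ z) := rfl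

theorem norm_comp_le (hp : p ≠ ⊤) (ψ : 𝔻 → 𝔻) (hψ : IsHolomorphic fun z => (ψ z : ℂ)) :
    ‖comp (p := p) hp ψ hψ‖ ≤ ((1 + ‖(ψ 0 : ℂ)‖) / (1 - ‖(ψ 0 : ℂ)‖)) ^ (1 / p.toReal) := by
  have hs := (ψ 0).norm_lt_one
  refine LinearMap.mkContinuous_norm_le _ (Real.rpow_nonneg ?_ _) _
  exact div_nonneg (by positivity) (by linarith)

end HardySpace

namespace BoundaryPair

variable (b : BoundaryPair)

/-- The composition operators induced by the hyperbolic flow. -/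
def flowComp (hp : p ≠ ⊤) (x : ℝ) : HardySpace p →L[ℂ] HardySpace p :=
  HardySpace.comp hp (b.flow x) (b.isHolomorphic_flow x)

@[simp] theorem flowComp_apply (hp : p ≠ ⊤) (x : ℝ) (f : HardySpace p) (z : 𝔻) :
    b.flowComp hp x f z = f (b.flow x z) := rfl

theorem flowComp_mul (hp : p ≠ ⊤) (x y : ℝ) :
    b.flowComp (p := p) hp x * b.flowComp hp y = b.flowComp hp (x + y) := by
  ext f z
  simp only [mul_apply_eq_comp, flowComp_apply, b.flow_flow, add_comm]

theorem flowComp_zero (hp : p ≠ ⊤) : b.flowComp (p := p) hp 0 = 1 := by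
  ext f z
  simp only [flowComp_apply, b.flow_zero, one_apply_eq_self]

theorem flowComp_pow (hp : p ≠ ⊤) (x : ℝ) (n : ℕ) :
    b.flowComp (p := p) hp x ^ n = b.flowComp hp (n * x) := by
  induction n with
  | zero => simp [flowComp_zero]
  | succ n ih =>
    rw [pow_succ, ih, flowComp_mul]
    push_cast
    ring_nf

theorem norm_flowComp_le (hp : p ≠ ⊤) (x : ℝ) : ‖b.flowComp (p := p) hp x‖ ≤
    (16 / ‖b.α - b.β‖ ^ 2) ^ (1 / p.toReal) * Real.exp (|x| / p.toReal) := by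
  have hq := one_le_toReal hp1.out hp
  refine (HardySpace.norm_comp_le hp _ _).trans ?_
  have h1 := b.one_sub_norm_flow_zero x
  have h2 := norm_nonneg (b.flow x 0 : ℂ)
  have h3 := (b.flow x 0).norm_lt_one
  set s := ‖(b.flow x 0 : ℂ)‖
  have hd : 0 < ‖b.α - b.β‖ := norm_pos_iff.2 b.sub_ne
  have h4 : (1 + s) / (1 - s) ≤ 16 / ‖b.α - b.β‖ ^ 2 * Real.exp |x| := by
    have h5 : ‖b.α - b.β‖ ^ 2 ≤ (1 - s ^ 2) * (4 * Real.exp |x|) := by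
      rwa [← div_eq_mul_inv, div_le_iff₀ (by positivity)] at h1
    rw [div_mul_eq_mul_div, div_le_div_iff₀ (by linarith) (by positivity)]
    have h6 : (1 + s) * ‖b.α - b.β‖ ^ 2 ≤ (1 + s) * ((1 - s ^ 2) * (4 * Real.exp |x|)) := by gcongr
    have h7 : (1 + s) * (1 - s ^ 2) ≤ 4 * (1 - s) := by
      have h9 : (1 + s) ^ 2 ≤ 4 := by nlinarith
      have h10 := mul_le_mul_of_nonneg_left h9 (by linarith : 0 ≤ 1 - s)
      linarith
    have h8 := mul_le_mul_of_nonneg_right h7 (by positivity : 0 ≤ 4 * Real.exp |x|)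
    linarith
  calc ((1 + s) / (1 - s)) ^ (1 / p.toReal)
      ≤ (16 / ‖b.α - b.β‖ ^ 2 * Real.exp |x|) ^ (1 / p.toReal) :=
        Real.rpow_le_rpow (div_nonneg (by linarith) (by linarith)) h4 (by positivity)
    _ = _ := by
        rw [Real.mul_rpow (by positivity) (by positivity), ← Real.exp_mul]
        ring_nf

end BoundaryPair

/-! ### Eigenfunctions of the flow -/

/-- Pointwise domination by a multiple of a sum bounds the Hardy norm. -/
theorem hardyENorm_le_of_norm_le {f g₁ g₂ : 𝔻 → ℂ} (hg₁ : IsHolomorphic g₁)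
    (hg₂ : IsHolomorphic g₂) {C : ℝ} (hC : 0 ≤ C) (h : ∀ z, ‖f z‖ ≤ C * (‖g₁ z‖ + ‖g₂ z‖)) :
    hardyENorm p f ≤ ENNReal.ofReal C * (hardyENorm p g₁ + hardyENorm p g₂) := by
  refine iSup₂_le fun r hr => ?_
  have hc1 := continuous_circle hg₁ hr
  have hc2 := continuous_circle hg₂ hr
  set c : ℝ → ℂ := fun θ => r * Complex.exp (θ * I) with hcdef
  have hcn : ∀ θ, ‖c θ‖ < 1 := fun θ => by
    rw [hcdef, norm_mul, Complex.norm_exp_ofReal_mul_I, mul_one, Complex.norm_of_nonneg hr.1]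
    exact hr.2
  have h1 : integralMean p f r ≤ eLpNorm (fun θ => C *
      (‖discExtend g₁ (c θ)‖ + ‖discExtend g₂ (c θ)‖)) p arcMeasure := by
    refine eLpNorm_mono_real fun θ => ?_
    change ‖discExtend f (c θ)‖ ≤ C * (‖discExtend g₁ (c θ)‖ + ‖discExtend g₂ (c θ)‖)
    rw [discExtend_of_norm_lt _ (hcn θ), discExtend_of_norm_lt _ (hcn θ),
      discExtend_of_norm_lt _ (hcn θ)]
    exact h _
  refine h1.trans ?_
  have h2 := eLpNorm_const_smul C (fun θ =>
    ‖discExtend g₁ (c θ)‖ + ‖discExtend g₂ (c θ)‖) p arcMeasure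
  refine h2.le.trans ?_
  rw [Real.enorm_eq_ofReal hC]
  refine mul_le_mul_right ?_ _
  refine (eLpNorm_add_le hc1.norm.aestronglyMeasurable hc2.norm.aestronglyMeasurable
    hp1.out).trans ?_
  rw [eLpNorm_norm, eLpNorm_norm]
  exact add_le_add (le_iSup₂ (f := fun r (_ : r ∈ Ico (0 : ℝ) 1) => integralMean p g₁ r) r hr)
    (le_iSup₂ (f := fun r (_ : r ∈ Ico (0 : ℝ) 1) => integralMean p g₂ r) r hr)

namespace HardySpace

/-- The element of `H^p` given by a member of the submodule of functions. -/
def mk (f : 𝔻 → ℂ) (hf : f ∈ hardySubmodule p) : HardySpace p := ⟨f, hf⟩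

@[simp] theorem mk_apply (f : 𝔻 → ℂ) (hf : f ∈ hardySubmodule p) (z : 𝔻) : mk f hf z = f z := rfl

/-- A holomorphic function dominated by elements of `H^p` belongs to `H^p`. -/
theorem mem_of_norm_le {f : 𝔻 → ℂ} (hf : IsHolomorphic f) (g₁ g₂ : HardySpace p) {C : ℝ}
    (hC : 0 ≤ C) (h : ∀ z, ‖f z‖ ≤ C * (‖g₁ z‖ + ‖g₂ z‖)) : f ∈ hardySubmodule p :=
  ⟨hf, (hardyENorm_le_of_norm_le g₁.2.1 g₂.2.1 hC h).trans_lt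
    (ENNReal.mul_lt_top ENNReal.ofReal_lt_top (ENNReal.add_lt_top.2 ⟨g₁.2.2, g₂.2.2⟩))⟩

theorem norm_le_of_norm_le (f g₁ g₂ : HardySpace p) {C : ℝ}
    (hC : 0 ≤ C) (h : ∀ z, ‖f z‖ ≤ C * (‖g₁ z‖ + ‖g₂ z‖)) : ‖f‖ ≤ C * (‖g₁‖ + ‖g₂‖) := by
  have h1 := hardyENorm_le_of_norm_le (p := p) g₁.2.1 g₂.2.1 hC h
  have h2 := ENNReal.toReal_mono (ENNReal.mul_ne_top ENNReal.ofReal_ne_top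
    (ENNReal.add_ne_top.2 ⟨g₁.2.2.ne, g₂.2.2.ne⟩)) h1
  rwa [ENNReal.toReal_mul, ENNReal.toReal_ofReal hC, ENNReal.toReal_add g₁.2.2.ne g₂.2.2.ne] at h2

end HardySpace

namespace BoundaryPair

variable (b : BoundaryPair)

/-- The logarithm of the half-plane coordinate, which maps the disc to the strip `|Im| < π / 2`. -/
def logCoord (z : ℂ) : ℂ := Complex.log (b.coord z)

theorem abs_im_logCoord_lt {z : ℂ} (hz : ‖z‖ < 1) : |(b.logCoord z).im| < Real.pi / 2 := by
  rw [logCoord, Complex.log_im]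
  exact Complex.abs_arg_lt_pi_div_two_iff.2 (Or.inl (b.re_coord_pos hz))

theorem logCoord_flow (x : ℝ) (z : 𝔻) : b.logCoord (b.flow x z) = x + b.logCoord z := by
  rw [logCoord, b.coord_flow, Complex.log_ofReal_mul (Real.exp_pos x)
    (b.coord_ne_zero z.norm_lt_one), Real.log_exp, logCoord]

/-- The function `v^s`. -/
def power (s z : ℂ) : ℂ := Complex.exp (s * b.logCoord z)

theorem differentiableOn_power (s : ℂ) : DifferentiableOn ℂ (b.power s) (ball 0 1) :=
  (b.differentiableOn_log_coord.const_mul s).cexp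

theorem norm_power (s z : ℂ) : ‖b.power s z‖ =
    Real.exp (s.re * (b.logCoord z).re - s.im * (b.logCoord z).im) := by
  rw [power, Complex.norm_exp, mul_re]

/-- The means of `|v|^a`, `|a| < 1`, are bounded: `|v|^a` is dominated by a multiple of the harmonic
function `Re v^a`, which has constant means. -/
theorem circleAverage_exp_re_logCoord_le {a r : ℝ} (ha : |a| < 1) (hr : r ∈ Ioo (0 : ℝ) 1) :
    circleAverage (fun z => Real.exp (a * (b.logCoord z).re)) 0 r ≤
      (b.power a 0).re / Real.cos (a * (Real.pi / 2)) := by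
  have hcos : 0 < Real.cos (a * (Real.pi / 2)) := by
    refine Real.cos_pos_of_mem_Ioo ⟨?_, ?_⟩ <;>
    nlinarith [abs_lt.1 ha, Real.pi_pos]
  have hsub := sphere_subset_ball_one ⟨hr.1.le, hr.2⟩
  have hd := b.differentiableOn_power a
  have hmean : circleAverage (fun z => (b.power a z).re) 0 r = (b.power a 0).re := by
    have h1 : DiffContOnCl ℂ (b.power a) (ball 0 |r|) := by
      rw [abs_of_pos hr.1]
      exact diffContOnCl_of_lt_one hd hr.2
    have h2 := congrArg re h1.circleAverage
    rw [← reCLM_apply, ← ContinuousLinearMap.circleAverage_comp_comm] at h2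
    · exact h2
    · exact (hd.continuousOn.mono hsub).circleIntegrable'
  rw [← hmean, div_eq_inv_mul, ← smul_eq_mul, ← Real.circleAverage_smul]
  have hlog : ContinuousOn b.logCoord (sphere 0 |r|) :=
    b.differentiableOn_log_coord.continuousOn.mono hsub
  refine Real.circleAverage_mono ?_ ?_ fun z hz => ?_
  · refine ContinuousOn.circleIntegrable' ?_
    exact Real.continuous_exp.comp_continuousOn
      (continuousOn_const.mul (continuous_re.comp_continuousOn hlog))
  · refine (ContinuousOn.circleIntegrable' ?_).const_smul
    exact continuous_re.comp_continuousOn (hd.continuousOn.mono hsub)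
  · have him := b.abs_im_logCoord_lt (mem_ball_zero_iff.1 (hsub hz))
    simp only [Pi.smul_apply, smul_eq_mul]
    rw [le_inv_mul_iff₀ hcos, power, Complex.exp_re, re_ofReal_mul, im_ofReal_mul, mul_comm]
    refine mul_le_mul_of_nonneg_left ?_ (Real.exp_pos _).le
    rw [← Real.cos_abs (a * (Real.pi / 2)), ← Real.cos_abs (a * (b.logCoord z).im), abs_mul,
      abs_mul, abs_of_pos (by positivity : 0 < Real.pi / 2)]
    refine Real.cos_le_cos_of_nonneg_of_le_pi (by positivity) ?_ ?_
    · nlinarith [abs_nonneg a, Real.pi_pos]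
    · exact mul_le_mul_of_nonneg_left him.le (abs_nonneg a)

theorem norm_power_le (s : ℂ) {z : ℂ} (hz : ‖z‖ < 1) : ‖b.power s z‖ ≤
    Real.exp (|s.im| * (Real.pi / 2)) * Real.exp (s.re * (b.logCoord z).re) := by
  rw [norm_power, ← Real.exp_add]
  refine Real.exp_le_exp.2 ?_
  have h1 : -(s.im * (b.logCoord z).im) ≤ |s.im| * |(b.logCoord z).im| := by
    rw [← abs_mul]; exact neg_le_abs _
  have h2 := mul_le_mul_of_nonneg_left (b.abs_im_logCoord_lt hz).le (abs_nonneg s.im)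
  linarith

theorem power_mem (hp : p ≠ ⊤) {s : ℂ} (hs : |s.re| < 1 / p.toReal) :
    (fun z : 𝔻 => b.power s z) ∈ hardySubmodule p := by
  have hq := one_le_toReal hp1.out hp
  set q := p.toReal with hqdef
  have hq0 : 0 < q := by linarith
  have ha : |q * s.re| < 1 := by
    rw [abs_mul, abs_of_pos hq0]
    rwa [lt_div_iff₀ hq0, mul_comm] at hs
  set M := Real.exp (|s.im| * (Real.pi / 2)) ^ q *
    ((b.power (q * s.re : ℝ) 0).re / Real.cos (q * s.re * (Real.pi / 2))) with hM
  have hbound : ∀ r ∈ Ioo (0 : ℝ) 1, circleAverage (fun z => ‖b.power s z‖ ^ q) 0 r ≤ M := by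
    intro r hr
    have hsub := sphere_subset_ball_one ⟨hr.1.le, hr.2⟩
    have hlog : ContinuousOn b.logCoord (sphere 0 |r|) :=
      b.differentiableOn_log_coord.continuousOn.mono hsub
    refine le_trans ?_ (mul_le_mul_of_nonneg_left (b.circleAverage_exp_re_logCoord_le ha hr)
      (by positivity))
    rw [← smul_eq_mul, ← Real.circleAverage_smul]
    refine Real.circleAverage_mono (circleIntegrable_norm_rpow hq0.le
      ((b.differentiableOn_power s).continuousOn.mono hsub)) ?_ fun z hz => ?_
    · refine (ContinuousOn.circleIntegrable' ?_).const_smul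
      exact Real.continuous_exp.comp_continuousOn
        (continuousOn_const.mul (continuous_re.comp_continuousOn hlog))
    · have h1 := Real.rpow_le_rpow (norm_nonneg _)
        (b.norm_power_le s (mem_ball_zero_iff.1 (hsub hz))) hq0.le
      refine h1.trans (le_of_eq ?_)
      rw [Real.mul_rpow (by positivity) (by positivity), ← Real.exp_mul (s.re * _) q]
      simp only [Pi.smul_apply, smul_eq_mul]
      ring_nf
  have hM0 : 0 ≤ M := le_trans (Real.circleAverage_nonneg_of_nonneg fun z _ => by positivity)
    (hbound (1 / 2) (by norm_num))
  exact (HardySpace.ofFun hp (b.power s) (b.differentiableOn_power s) (M ^ (1 / q))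
    (by positivity) fun r hr => by
      rw [← hqdef, ← Real.rpow_mul hM0, one_div_mul_cancel hq0.ne', Real.rpow_one]
      exact hbound r hr).2

open Classical in
/-- The function `v^s` as an element of `H^p`, for `|Re s| < 1/p`; zero for all other `s`. -/
def powerElt (p : ℝ≥0∞) [hp1 : Fact (1 ≤ p)] (s : ℂ) : HardySpace p :=
  if h : (fun z : 𝔻 => b.power s z) ∈ hardySubmodule p then HardySpace.mk _ h else 0

theorem powerElt_apply (hp : p ≠ ⊤) {s : ℂ} (hs : |s.re| < 1 / p.toReal) (z : 𝔻) :
    b.powerElt p s z = b.power s z := by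
  rw [powerElt, dif_pos (b.power_mem hp hs), HardySpace.mk_apply]

theorem flowComp_powerElt (hp : p ≠ ⊤) {s : ℂ} (hs : |s.re| < 1 / p.toReal) (x : ℝ) :
    b.flowComp hp x (b.powerElt p s) = Complex.exp (s * x) • b.powerElt p s := by
  ext z
  rw [flowComp_apply, HardySpace.coe_smul, b.powerElt_apply hp hs, b.powerElt_apply hp hs, power,
    power, b.logCoord_flow, ← Complex.exp_add]
  ring_nf

theorem norm_logCoord_le {z : ℂ} (hz : ‖z‖ < 1) :
    ‖b.logCoord z‖ ≤ |(b.logCoord z).re| + Real.pi / 2 :=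
  (Complex.norm_le_abs_re_add_abs_im _).trans (by gcongr; exact (b.abs_im_logCoord_lt hz).le)

theorem exp_norm_logCoord_mul_norm_power_le {η : ℝ} (hη : 0 ≤ η) (s : ℂ) {z : ℂ} (hz : ‖z‖ < 1) :
    Real.exp (η * ‖b.logCoord z‖) * ‖b.power s z‖ ≤
      Real.exp (η * (Real.pi / 2) + |s.im| * (Real.pi / 2)) *
        (‖b.power (s.re - η : ℝ) z‖ + ‖b.power (s.re + η : ℝ) z‖) := by
  have h1 := b.norm_power_le s hz
  have h2 := mul_le_mul_of_nonneg_left (b.norm_logCoord_le hz) hη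
  have h3 : Real.exp (η * |(b.logCoord z).re|) ≤
      Real.exp (-η * (b.logCoord z).re) + Real.exp (η * (b.logCoord z).re) := by
    rcases abs_cases (b.logCoord z).re with ⟨h, -⟩ | ⟨h, -⟩ <;> rw [h]
    · linarith [Real.exp_pos (-η * (b.logCoord z).re)]
    · rw [mul_neg, ← neg_mul]
      linarith [Real.exp_pos (η * (b.logCoord z).re)]
  have h4 : ∀ a : ℝ, ‖b.power a z‖ = Real.exp (a * (b.logCoord z).re) := fun a => by
    rw [norm_power, ofReal_re, ofReal_im]; simp
  rw [h4, h4]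
  calc Real.exp (η * ‖b.logCoord z‖) * ‖b.power s z‖
      ≤ Real.exp (η * |(b.logCoord z).re| + η * (Real.pi / 2)) *
        (Real.exp (|s.im| * (Real.pi / 2)) * Real.exp (s.re * (b.logCoord z).re)) := by
        gcongr
        linarith
    _ = Real.exp (η * (Real.pi / 2)) * Real.exp (|s.im| * (Real.pi / 2)) *
        (Real.exp (s.re * (b.logCoord z).re) * Real.exp (η * |(b.logCoord z).re|)) := by
        rw [Real.exp_add]; ring
    _ ≤ Real.exp (η * (Real.pi / 2)) * Real.exp (|s.im| * (Real.pi / 2)) *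
        (Real.exp (s.re * (b.logCoord z).re) *
        (Real.exp (-η * (b.logCoord z).re) + Real.exp (η * (b.logCoord z).re))) := by gcongr
    _ = _ := by
        have e1 : ∀ y, Real.exp ((s.re + y) * (b.logCoord z).re) =
            Real.exp (s.re * (b.logCoord z).re) * Real.exp (y * (b.logCoord z).re) := fun y => by
          rw [add_mul, Real.exp_add]
        rw [sub_eq_add_neg, e1, e1, Real.exp_add]
        ring

/-- `s ↦ v^s` is a holomorphic map from the strip `|Re s| < 1/p` to `H^p`. -/
theorem exists_hasDerivAt_powerElt (hp : p ≠ ⊤) {s : ℂ} (hs : |s.re| < 1 / p.toReal) :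
    ∃ d, HasDerivAt (b.powerElt p) d s := by
  obtain ⟨η, hη0, hη⟩ : ∃ η > 0, |s.re| + 2 * η < 1 / p.toReal :=
    ⟨(1 / p.toReal - |s.re|) / 4, by linarith, by linarith⟩
  have hs1 : |((s.re - 2 * η : ℝ) : ℂ).re| < 1 / p.toReal := by
    rw [ofReal_re]
    calc |s.re - 2 * η| ≤ |s.re| + |2 * η| := abs_sub _ _
      _ < _ := by rwa [abs_of_pos (by linarith : 0 < 2 * η)]
  have hs2 : |((s.re + 2 * η : ℝ) : ℂ).re| < 1 / p.toReal := by
    rw [ofReal_re]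
    calc |s.re + 2 * η| ≤ |s.re| + |2 * η| := abs_add_le _ _
      _ < _ := by rwa [abs_of_pos (by linarith : 0 < 2 * η)]
  set g₁ := b.powerElt p (s.re - 2 * η : ℝ) with hg₁
  set g₂ := b.powerElt p (s.re + 2 * η : ℝ) with hg₂
  set A := Real.exp (2 * η * (Real.pi / 2) + |s.im| * (Real.pi / 2)) with hA
  have hdom : ∀ z : 𝔻, Real.exp (2 * η * ‖b.logCoord z‖) * ‖b.power s z‖ ≤
      A * (‖g₁ z‖ + ‖g₂ z‖) := fun z => by
    rw [hg₁, hg₂, b.powerElt_apply hp hs1, b.powerElt_apply hp hs2]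
    exact b.exp_norm_logCoord_mul_norm_power_le (by linarith) s z.norm_lt_one
  -- the derivative is `log v * v^s`
  have hdmem : (fun z : 𝔻 => b.logCoord z * b.power s z) ∈ hardySubmodule p := by
    refine HardySpace.mem_of_norm_le (C := η⁻¹ * A)
      (isHolomorphic_of_differentiableOn (F := fun z => b.logCoord z * b.power s z)
        (b.differentiableOn_log_coord.mul (b.differentiableOn_power s))) g₁ g₂ (by positivity)
      fun z => ?_
    rw [norm_mul, mul_assoc]
    have h1 : ‖b.logCoord z‖ ≤ η⁻¹ * Real.exp (2 * η * ‖b.logCoord z‖) := by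
      rw [le_inv_mul_iff₀ hη0]
      have := Real.add_one_le_exp (2 * η * ‖b.logCoord z‖)
      nlinarith [norm_nonneg (b.logCoord z)]
    calc ‖b.logCoord z‖ * ‖b.power s z‖
        ≤ (η⁻¹ * Real.exp (2 * η * ‖b.logCoord z‖)) * ‖b.power s z‖ := by gcongr
      _ = η⁻¹ * (Real.exp (2 * η * ‖b.logCoord z‖) * ‖b.power s z‖) := by ring
      _ ≤ η⁻¹ * (A * (‖g₁ z‖ + ‖g₂ z‖)) := mul_le_mul_of_nonneg_left (hdom z) (by positivity)
  obtain ⟨D, hD⟩ : ∃ D : HardySpace p, ∀ z : 𝔻, D z = b.logCoord z * b.power s z :=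
    ⟨HardySpace.mk _ hdmem, fun z => rfl⟩
  refine ⟨D, hasDerivAt_iff_isLittleO_nhds_zero.2 ?_⟩
  have hO : (fun h : ℂ => b.powerElt p (s + h) - b.powerElt p s - h • D) =O[𝓝 0]
      fun h : ℂ => ‖h‖ ^ 2 := by
    refine Asymptotics.IsBigO.of_bound (2 * (η⁻¹ ^ 2) * A * (‖g₁‖ + ‖g₂‖)) ?_
    filter_upwards [ball_mem_nhds (0 : ℂ) hη0] with h hh
    rw [mem_ball_zero_iff] at hh
    have hsh : |(s + h).re| < 1 / p.toReal := by
      rw [add_re]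
      have := abs_add_le s.re h.re
      have := Complex.abs_re_le_norm h
      linarith
    rw [Real.norm_of_nonneg (by positivity)]
    have key : ‖b.powerElt p (s + h) - b.powerElt p s - h • D‖ ≤
        (‖h‖ ^ 2 * (2 * η⁻¹ ^ 2) * A) * (‖g₁‖ + ‖g₂‖) := by
      refine HardySpace.norm_le_of_norm_le _ _ _ (by positivity) fun z => ?_
      rw [HardySpace.coe_sub, HardySpace.coe_sub, HardySpace.coe_smul, hD,
        b.powerElt_apply hp hs, b.powerElt_apply hp hsh]
      set L := b.logCoord z with hL
      have e1 : b.power (s + h) z - b.power s z - h * (L * b.power s z) =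
          (Complex.exp (h * L) - 1 - h * L) * b.power s z := by
        rw [power, power, ← hL, add_mul, Complex.exp_add]; ring
      have e2 : ‖Complex.exp (h * L) - 1 - h * L‖ ≤ ‖h * L‖ ^ 2 * Real.exp ‖h * L‖ := by
        have := Complex.norm_exp_sub_sum_le_norm_mul_exp (h * L) 2
        simpa [Finset.sum_range_succ, sub_sub] using this
      have e3 : ‖L‖ ^ 2 ≤ 2 * η⁻¹ ^ 2 * Real.exp (η * ‖L‖) := by
        have := Real.quadratic_le_exp_of_nonneg (x := η * ‖L‖) (by positivity)
        have h4 : (η * ‖L‖) ^ 2 ≤ 2 * Real.exp (η * ‖L‖) := by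
          have : 0 ≤ η * ‖L‖ := by positivity
          linarith
        calc ‖L‖ ^ 2 = η⁻¹ ^ 2 * (η * ‖L‖) ^ 2 := by field_simp
          _ ≤ η⁻¹ ^ 2 * (2 * Real.exp (η * ‖L‖)) := by gcongr
          _ = _ := by ring
      rw [e1, norm_mul]
      calc ‖Complex.exp (h * L) - 1 - h * L‖ * ‖b.power s z‖
          ≤ (‖h‖ ^ 2 * (2 * η⁻¹ ^ 2 * Real.exp (η * ‖L‖)) * Real.exp (η * ‖L‖)) *
            ‖b.power s z‖ := by
            refine mul_le_mul_of_nonneg_right (e2.trans ?_) (norm_nonneg _)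
            rw [norm_mul, mul_pow]
            gcongr
        _ = ‖h‖ ^ 2 * (2 * η⁻¹ ^ 2) * (Real.exp (2 * η * ‖L‖) * ‖b.power s z‖) := by
            rw [show 2 * η * ‖L‖ = η * ‖L‖ + η * ‖L‖ by ring, Real.exp_add]; ring
        _ ≤ ‖h‖ ^ 2 * (2 * η⁻¹ ^ 2) * (A * (‖g₁ z‖ + ‖g₂ z‖)) := by
            exact mul_le_mul_of_nonneg_left (hdom z) (by positivity)
        _ = _ := by ring
    refine key.trans (le_of_eq (by ring))
  refine hO.trans_isLittleO ?_
  exact (Asymptotics.isLittleO_norm_pow_id one_lt_two)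

end BoundaryPair

/-! ### Density of the eigenfunctions -/

theorem norm_pow_sub_pow_le {x y : ℂ} {M : ℝ} (hM : 1 ≤ M) (hx : ‖x‖ ≤ M) (hy : ‖y‖ ≤ M) (n : ℕ) :
    ‖x ^ n - y ^ n‖ ≤ n * M ^ n * ‖x - y‖ := by
  induction n with
  | zero => simp
  | succ n ih =>
    have e : x ^ (n + 1) - y ^ (n + 1) = x * (x ^ n - y ^ n) + (x - y) * y ^ n := by ring
    have hM0 : 0 ≤ M := by linarith
    have h1 : ‖y ^ n‖ ≤ M ^ n := by
      rw [norm_pow]; gcongr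
    rw [e]
    calc ‖x * (x ^ n - y ^ n) + (x - y) * y ^ n‖
        ≤ ‖x‖ * ‖x ^ n - y ^ n‖ + ‖x - y‖ * ‖y ^ n‖ := by
          simpa only [norm_mul] using norm_add_le (x * (x ^ n - y ^ n)) ((x - y) * y ^ n)
      _ ≤ M * (n * M ^ n * ‖x - y‖) + ‖x - y‖ * (M ^ n * M) := by
          gcongr
          exact h1.trans (le_mul_of_one_le_right (by positivity) hM)
      _ = _ := by push_cast; ring

namespace BoundaryPair

variable (b : BoundaryPair)

theorem re_κ_mul_le {z : ℂ} (hz : ‖z‖ < 1) (t : ℝ) : b.κ.re * t ≤ ‖b.coord z + b.κ * t‖ := by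
  have h1 := Complex.re_le_norm (b.coord z + b.κ * t)
  rw [add_re, Complex.re_mul_ofReal] at h1
  linarith [b.re_coord_pos hz]

theorem norm_coord_le {z : ℂ} (hz : ‖z‖ < 1) {t : ℝ} (ht : 0 ≤ t) :
    b.κ.re / (b.κ.re + ‖b.κ‖) * ‖b.coord z‖ ≤ ‖b.coord z + b.κ * t‖ := by
  have h1 := b.re_κ_mul_le hz t
  have h2 : ‖b.coord z‖ ≤ ‖b.coord z + b.κ * t‖ + ‖b.κ‖ * t := by
    have := norm_sub_le (b.coord z + b.κ * t) (b.κ * t)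
    rwa [add_sub_cancel_right, norm_mul, Complex.norm_of_nonneg ht] at this
  have hκ := b.re_κ_pos
  rw [div_mul_eq_mul_div, div_le_iff₀ (by positivity)]
  nlinarith [norm_nonneg b.κ]

theorem coord_add_ne {z : ℂ} (hz : ‖z‖ < 1) {t : ℝ} (ht : 0 < t) : b.coord z + b.κ * t ≠ 0 := by
  rw [← norm_pos_iff]
  exact (mul_pos b.re_κ_pos ht).trans_le (b.re_κ_mul_le hz t)

theorem norm_inv_coord_add_le {z : ℂ} (hz : ‖z‖ < 1) {t : ℝ} (ht : 0 < t) :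
    ‖(b.coord z + b.κ * t)⁻¹‖ ≤ (b.κ.re * t)⁻¹ := by
  rw [norm_inv]
  exact inv_anti₀ (mul_pos b.re_κ_pos ht) (b.re_κ_mul_le hz t)

/-- The function `(v + κ t)⁻ⁿ`, `t > 0`, as an element of `H^p`; zero for `t ≤ 0`. -/
def kernelElt (hp : p ≠ ⊤) (n : ℕ) (t : ℝ) : HardySpace p :=
  if ht : 0 < t then
    HardySpace.ofBounded hp (fun z => ((b.coord z + b.κ * t)⁻¹) ^ n)
      (((b.differentiableOn_coord.add_const _).inv fun _ hz =>
        b.coord_add_ne (mem_ball_zero_iff.1 hz) ht).pow n)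
      ((b.κ.re * t)⁻¹ ^ n) (fun z hz => by
        rw [norm_pow]
        exact pow_le_pow_left₀ (norm_nonneg _)
          (b.norm_inv_coord_add_le (mem_ball_zero_iff.1 hz) ht) n)
  else 0

theorem kernelElt_apply (hp : p ≠ ⊤) (n : ℕ) {t : ℝ} (ht : 0 < t) (z : 𝔻) :
    b.kernelElt hp n t z = ((b.coord z + b.κ * t)⁻¹) ^ n := by
  rw [kernelElt, dif_pos ht, HardySpace.ofBounded_apply]

/-- Interpolating between `|v + κ t| ≥ c t` and `|v + κ t| ≥ c |v|` bounds the kernels in norm. -/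
theorem exists_norm_kernelElt_le (hp : p ≠ ⊤) (n : ℕ) {a : ℝ} (ha0 : 0 ≤ a) (han : a ≤ n)
    (ha : a < 1 / p.toReal) :
    ∃ C, ∀ t, 0 < t → ‖b.kernelElt (p := p) hp n t‖ ≤ C * t ^ (-(n - a)) := by
  have hκ := b.re_κ_pos
  set c := b.κ.re / (b.κ.re + ‖b.κ‖) with hc
  have hc0 : 0 < c := by positivity
  have hs : |((-a : ℝ) : ℂ).re| < 1 / p.toReal := by
    rwa [ofReal_re, abs_neg, abs_of_nonneg ha0]
  refine ⟨b.κ.re ^ (-(n - a)) * c ^ (-a) *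
    (‖b.powerElt p (-a : ℝ)‖ + ‖(0 : HardySpace p)‖), fun t ht => ?_⟩
  have key : ‖b.kernelElt (p := p) hp n t‖ ≤ (b.κ.re * t) ^ (-(n - a)) * c ^ (-a) *
      (‖b.powerElt p (-a : ℝ)‖ + ‖(0 : HardySpace p)‖) := by
    refine HardySpace.norm_le_of_norm_le _ _ _ (by positivity) fun z => ?_
    have hz := z.norm_lt_one
    have hv : 0 < ‖b.coord z‖ := norm_pos_iff.2 (b.coord_ne_zero hz)
    have hN : 0 < ‖b.coord z + b.κ * t‖ := norm_pos_iff.2 (b.coord_add_ne hz ht)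
    rw [b.kernelElt_apply hp n ht, b.powerElt_apply hp hs, norm_pow, norm_inv, norm_power,
      ofReal_re, ofReal_im, zero_mul, sub_zero, logCoord, Complex.log_re]
    set N := ‖b.coord z + b.κ * t‖ with hNdef
    have e1 : N⁻¹ ^ n = N ^ (-(n - a)) * N ^ (-a) := by
      rw [← Real.rpow_add hN, show -(n - a) + -a = -(n : ℝ) by ring, Real.rpow_neg hN.le,
        Real.rpow_natCast, inv_pow]
    have e2 : Real.exp (-a * Real.log ‖b.coord z‖) = ‖b.coord z‖ ^ (-a) := by
      rw [Real.rpow_def_of_pos hv, mul_comm]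
    rw [e1, e2]
    have h1 : N ^ (-(n - a)) ≤ (b.κ.re * t) ^ (-(n - a)) :=
      Real.rpow_le_rpow_of_nonpos (by positivity) (b.re_κ_mul_le hz t) (by linarith)
    have h2 : N ^ (-a) ≤ (c * ‖b.coord z‖) ^ (-a) :=
      Real.rpow_le_rpow_of_nonpos (by positivity) (b.norm_coord_le hz ht.le) (by linarith)
    rw [Real.mul_rpow hc0.le hv.le] at h2
    calc N ^ (-(n - a)) * N ^ (-a)
        ≤ (b.κ.re * t) ^ (-(n - a)) * (c ^ (-a) * ‖b.coord z‖ ^ (-a)) := by gcongr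
      _ ≤ (b.κ.re * t) ^ (-(n - a)) * (c ^ (-a) *
          (‖b.coord z‖ ^ (-a) + ‖(0 : HardySpace p) z‖)) := by
          gcongr
          exact le_add_of_nonneg_right (norm_nonneg _)
      _ = _ := by ring
  refine key.trans (le_of_eq ?_)
  rw [Real.mul_rpow hκ.le ht.le]
  ring

theorem continuousOn_kernelElt (hp : p ≠ ⊤) (n : ℕ) :
    ContinuousOn (b.kernelElt (p := p) hp n) (Ioi 0) := by
  intro t₀ ht₀
  rw [mem_Ioi] at ht₀
  refine ContinuousAt.continuousWithinAt ?_
  have hκ := b.re_κ_pos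
  set M := max 1 ((b.κ.re * (t₀ / 2))⁻¹) with hM
  have hM1 : 1 ≤ M := le_max_left _ _
  have hb : ∀ t, t₀ / 2 < t → ∀ z : 𝔻, ‖(b.coord z + b.κ * t)⁻¹‖ ≤ M := fun t ht z => by
    refine (b.norm_inv_coord_add_le z.norm_lt_one (by linarith)).trans
      (le_trans ?_ (le_max_right _ _))
    exact inv_anti₀ (by positivity) (by gcongr)
  have hev : ∀ᶠ t in 𝓝 t₀, t₀ / 2 < t := lt_mem_nhds (by linarith)
  refine tendsto_iff_norm_sub_tendsto_zero.2 (squeeze_zero' (Eventually.of_forall fun t =>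
    norm_nonneg _) (g := fun t => n * M ^ n * (M * M * ‖b.κ‖) * |t - t₀|) ?_ ?_)
  · filter_upwards [hev] with t ht
    have ht0 : 0 < t := by linarith
    refine HardySpace.norm_le_of_bound hp _ fun z => ?_
    rw [HardySpace.coe_sub, b.kernelElt_apply hp n ht0, b.kernelElt_apply hp n ht₀]
    refine (norm_pow_sub_pow_le hM1 (hb t ht z) (hb t₀ (by linarith) z) n).trans ?_
    rw [mul_assoc _ (M * M * ‖b.κ‖)]
    refine mul_le_mul_of_nonneg_left ?_ (by positivity)
    have h1 := b.coord_add_ne z.norm_lt_one ht0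
    have h2 := b.coord_add_ne z.norm_lt_one ht₀
    have e : (b.coord z + b.κ * t)⁻¹ - (b.coord z + b.κ * t₀)⁻¹ =
        (b.coord z + b.κ * t)⁻¹ * (b.coord z + b.κ * t₀)⁻¹ * b.κ * ((t₀ - t : ℝ) : ℂ) := by
      push_cast
      field_simp
      ring
    rw [e, norm_mul, norm_mul, norm_mul, Complex.norm_real, Real.norm_eq_abs, abs_sub_comm]
    gcongr
    · exact hb t ht z
    · exact hb t₀ (by linarith) z
  · have : Continuous fun t : ℝ => n * M ^ n * (M * M * ‖b.κ‖) * |t - t₀| := by fun_prop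
    simpa using this.tendsto t₀

theorem mellinConvergent_kernelElt (hp : p ≠ ⊤) {n : ℕ} (hn : 1 ≤ n) {s : ℂ} {a : ℝ} (ha0 : 0 ≤ a)
    (ha : a < 1 / p.toReal) (hs : (n - a : ℝ) < s.re) (hsn : s.re < n) :
    MellinConvergent (b.kernelElt (p := p) hp n) s := by
  have hq := one_le_toReal hp1.out hp
  have hn' : (1 : ℝ) ≤ n := by exact_mod_cast hn
  have hq1 : 1 / p.toReal ≤ 1 := by rw [div_le_one (by linarith)]; exact hq
  have hq0 : 0 < 1 / p.toReal := by positivity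
  obtain ⟨C, hC⟩ := b.exists_norm_kernelElt_le hp n le_rfl (by positivity) hq0
  obtain ⟨D, hD⟩ := b.exists_norm_kernelElt_le hp n ha0 (by linarith) ha
  refine mellinConvergent_of_isBigO_rpow (a := n) (b := n - a)
    ((b.continuousOn_kernelElt hp n).locallyIntegrableOn measurableSet_Ioi) ?_ hsn ?_ hs
  · refine Asymptotics.IsBigO.of_bound C ?_
    filter_upwards [eventually_gt_atTop 0] with t ht
    rw [Real.norm_of_nonneg (by positivity)]
    simpa using hC t ht
  · refine Asymptotics.IsBigO.of_bound D ?_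
    filter_upwards [self_mem_nhdsWithin] with t ht
    have ht' : 0 < t := ht
    rw [Real.norm_of_nonneg (by positivity)]
    exact hD t ht'

/-- Two elements of `H^p` that agree on the circular arc `v = κ x`, `x > 0`, are equal. -/
theorem eq_of_eqOn_arc {f g : HardySpace p}
    (h : ∀ x : ℝ, 0 < x → ∀ z : 𝔻, b.coord z = b.κ * x → f z = g z) : f = g := by
  have hpos : ∀ x : ℝ, 0 < x → 0 < (b.κ * x).re := fun x hx => by
    rw [Complex.re_mul_ofReal]
    exact mul_pos b.re_κ_pos hx
  set γ : ℝ → ℂ := fun x => b.invCoord (b.κ * x) with hγ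
  have hγ1 : ∀ x : ℝ, 0 < x → γ x ∈ ball (0 : ℂ) 1 := fun x hx =>
    mem_ball_zero_iff.2 (b.norm_invCoord_lt (hpos x hx))
  have hcont : ContinuousAt γ 1 := by
    have h1 := b.κ_add_ne (hpos 1 one_pos)
    have : ContinuousAt (fun x : ℝ => (b.α * b.κ + b.β * (b.κ * x)) / (b.κ + b.κ * x)) 1 := by
      fun_prop (disch := assumption)
    exact this
  have hev : ∀ᶠ x : ℝ in 𝓝[≠] 1, 0 < x :=
    nhdsWithin_le_nhds (lt_mem_nhds one_pos)
  have htend : Tendsto γ (𝓝[≠] 1) (𝓝[≠] (γ 1)) := by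
    refine tendsto_nhdsWithin_iff.2 ⟨hcont.tendsto.mono_left nhdsWithin_le_nhds, ?_⟩
    filter_upwards [hev, self_mem_nhdsWithin] with x hx hx1 hxγ
    apply hx1
    have h2 := congrArg b.coord hxγ
    rw [b.coord_invCoord (hpos x hx), b.coord_invCoord (hpos 1 one_pos)] at h2
    have h3 := mul_left_cancel₀ b.κ_ne h2
    exact_mod_cast h3
  have hfreq : ∃ᶠ z in 𝓝[≠] (γ 1), discExtend f.1 z = discExtend g.1 z := by
    refine htend.frequently (Eventually.frequently ?_)
    filter_upwards [hev] with x hx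
    have hx1 := mem_ball_zero_iff.1 (hγ1 x hx)
    rw [discExtend_of_norm_lt _ hx1, discExtend_of_norm_lt _ hx1]
    exact h x hx _ (b.coord_invCoord (hpos x hx))
  have heq := AnalyticOnNhd.eqOn_of_preconnected_of_frequently_eq
    (f.2.1.analyticOnNhd isOpen_ball) (g.2.1.analyticOnNhd isOpen_ball)
    (convex_ball 0 1).isPreconnected (hγ1 1 one_pos) hfreq
  ext z
  have := heq (mem_ball_zero_iff.2 z.norm_lt_one)
  rwa [discExtend_coe, discExtend_coe] at this

/-- The Mellin transform of `t ↦ (v + κ t)⁻ⁿ` at `s` is a multiple of `v^(s - n)`: both sides are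
homogeneous of the same degree on the arc `v = κ x`. -/
theorem exists_mellin_kernelElt_eq (hp : p ≠ ⊤) {n : ℕ} {s : ℂ}
    (hconv : MellinConvergent (b.kernelElt (p := p) hp n) s) (hs : |(s - n).re| < 1 / p.toReal) :
    ∃ c : ℂ, mellin (b.kernelElt (p := p) hp n) s = c • b.powerElt p (s - n) := by
  have := HardySpace.completeSpace hp (p := p)
  set f : ℝ → ℂ := fun t => (b.κ⁻¹) ^ n * ((1 + (t : ℂ))⁻¹) ^ n with hf
  refine ⟨mellin f s * Complex.exp (-((s - n) * Complex.log b.κ)),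
    b.eq_of_eqOn_arc fun x hx z hz => ?_⟩
  have hx0 : (x : ℂ) ≠ 0 := ofReal_ne_zero.2 hx.ne'
  have h1 : mellin (b.kernelElt (p := p) hp n) s z =
      mellin (fun t : ℝ => ((x : ℂ)⁻¹ ^ n) • f (x⁻¹ * t)) s := by
    rw [← HardySpace.evalCLM_apply hp, mellin, ← ContinuousLinearMap.integral_comp_comm _ hconv,
      mellin]
    refine setIntegral_congr_fun measurableSet_Ioi fun t ht => ?_
    simp only [HardySpace.evalCLM_apply, HardySpace.coe_smul, smul_eq_mul, hf]
    rw [b.kernelElt_apply hp n ht, hz, ← mul_pow, ← mul_pow, ← mul_inv, ← mul_inv]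
    congr 3
    push_cast
    field_simp
  have h2 : Complex.exp ((s - n) * Complex.log x) = (x : ℂ)⁻¹ ^ n * ((x⁻¹ : ℝ) : ℂ) ^ (-s) := by
    rw [ofReal_inv, Complex.inv_cpow _ _ (by
      rw [Complex.arg_ofReal_of_nonneg hx.le]; exact Real.pi_pos.ne), Complex.cpow_neg, inv_inv,
      sub_mul, Complex.exp_sub, Complex.cpow_def_of_ne_zero hx0, Complex.exp_nat_mul,
      Complex.exp_log hx0, inv_pow, div_eq_inv_mul, mul_comm s]
  rw [h1, mellin_const_smul, mellin_comp_mul_left f s (inv_pos.2 hx), HardySpace.coe_smul,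
    b.powerElt_apply hp hs, power, logCoord, hz, mul_comm b.κ, Complex.log_ofReal_mul hx b.κ_ne,
    mul_add, Complex.exp_add, Complex.exp_neg, Complex.ofReal_log hx.le, h2, smul_eq_mul,
    smul_eq_mul]
  have := Complex.exp_ne_zero ((s - n) * Complex.log b.κ)
  field_simp

/-- The functions `v^s`, `|Re s| < 1/p`, span a dense subspace of `H^p`, `1 < p < ∞`. A functional
that kills them annihilates the Mellin transforms of `t ↦ (v + κ t)⁻ⁿ`, so by Mellin inversion it
kills `(v + κ)⁻ⁿ`, which is a multiple of `(z - β)ⁿ`. -/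
theorem eq_zero_of_forall_powerElt (hpp : 1 < p) (hp : p ≠ ⊤) (Λ : StrongDual ℂ (HardySpace p))
    (h : ∀ s : ℂ, |s.re| < 1 / p.toReal → Λ (b.powerElt p s) = 0) : Λ = 0 := by
  have := HardySpace.completeSpace hp (p := p)
  have hq := one_le_toReal hp1.out hp
  have hq0 : 0 < 1 / p.toReal := by positivity
  refine HardySpace.eq_zero_of_forall_pow hpp hp Λ b.β fun n => ?_
  rcases Nat.eq_zero_or_pos n with rfl | hn
  · have : HardySpace.ofPolynomial hp ((Polynomial.X - Polynomial.C b.β) ^ 0) =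
        b.powerElt p 0 := by
      ext z
      rw [b.powerElt_apply hp (by simpa using hq0)]
      simp [power]
    rw [this]
    exact h 0 (by simpa using hq0)
  set a := 1 / p.toReal / 2 with ha
  have ha0 : 0 < a := by positivity
  have ha1 : a < 1 / p.toReal := by linarith
  set σ : ℝ := n - a / 2 with hσ
  have hconv : ∀ s : ℂ, s.re = σ → MellinConvergent (b.kernelElt (p := p) hp n) s := fun s hs =>
    b.mellinConvergent_kernelElt hp hn ha0.le ha1 (by rw [hs, hσ]; linarith)
      (by rw [hs, hσ]; linarith)
  have hzero : ∀ s : ℂ, s.re = σ → mellin (fun t => Λ (b.kernelElt (p := p) hp n t)) s = 0 := by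
    intro s hs
    have hre : |(s - n).re| < 1 / p.toReal := by
      rw [sub_re, natCast_re, hs, hσ, sub_sub_cancel_left, abs_neg, abs_of_pos (by positivity)]
      linarith
    obtain ⟨c, hc⟩ := b.exists_mellin_kernelElt_eq hp (hconv s hs) hre
    have h1 := ContinuousLinearMap.integral_comp_comm Λ (hconv s hs)
    rw [← mellin, hc, map_smul, h _ hre, smul_zero] at h1
    rw [mellin, ← h1]
    simp only [map_smul]
  have hΛconv : MellinConvergent (fun t => Λ (b.kernelElt (p := p) hp n t)) σ := by
    have := ContinuousLinearMap.integrable_comp Λ (hconv σ (ofReal_re σ))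
    simpa only [MellinConvergent, IntegrableOn, map_smul] using this
  have hvert : ∀ y : ℝ, mellin (fun t => Λ (b.kernelElt (p := p) hp n t)) (σ + y * I) = 0 :=
    fun y => hzero _ (by simp)
  have hinv := mellinInv_mellin_eq σ (fun t => Λ (b.kernelElt (p := p) hp n t)) one_pos hΛconv
    (by simp only [Complex.VerticalIntegrable, hvert]; exact integrable_zero _ _ _)
    ((Λ.continuous.continuousAt).comp
      ((b.continuousOn_kernelElt hp n).continuousAt (Ioi_mem_nhds one_pos)))
  simp only [mellinInv, hvert, smul_zero, integral_zero] at hinv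
  have hpoly : HardySpace.ofPolynomial hp ((Polynomial.X - Polynomial.C b.β) ^ n) =
      (b.κ * (b.α - b.β)) ^ n • b.kernelElt (p := p) hp n 1 := by
    ext z
    have h1 := b.sub_β_ne z.norm_lt_one
    have h2 := b.κ_ne
    have h3 := b.sub_ne
    have e : b.coord z + b.κ * (1 : ℝ) = b.κ * (b.α - b.β) / (z - b.β) := by
      rw [coord]; push_cast; field_simp; ring
    rw [HardySpace.coe_smul, b.kernelElt_apply hp n one_pos, ← mul_pow, e]
    simp only [HardySpace.ofPolynomial_apply, Polynomial.eval_pow, Polynomial.eval_sub,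
      Polynomial.eval_X, Polynomial.eval_C]
    congr 1
    field_simp
  rw [hpoly, map_smul, ← hinv, smul_zero]

end BoundaryPair

/-! ### Operators whose adjoint has an analytic family of eigenvectors -/

section LocalSpectralTheory

variable {Y : Type*} [NormedAddCommGroup Y] [NormedSpace ℂ Y]

theorem resolvent_apply_of_mem {T : Y →L[ℂ] Y} {z : ℂ} (hz : z ∈ resolventSet ℂ T) (y : Y) :
    T (resolvent T z y) - z • resolvent T z y = -y := by
  have h := congrArg (fun A : Y →L[ℂ] Y => A y) (Ring.mul_inverse_cancel _ hz)
  simp only [mul_apply_eq_comp, one_apply_eq_self] at h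
  rw [sub_apply, Algebra.algebraMap_eq_smul_one,
    smul_apply, one_apply_eq_self] at h
  rw [resolvent, Algebra.algebraMap_eq_smul_one, ← neg_sub]
  exact congrArg Neg.neg h

theorem resolvent_apply_sub {T : Y →L[ℂ] Y} {z : ℂ} (hz : z ∈ resolventSet ℂ T) (y : Y) :
    resolvent T z (z • y - T y) = y := by
  have h := congrArg (fun A : Y →L[ℂ] Y => A y) (Ring.inverse_mul_cancel _ hz)
  simpa [Algebra.algebraMap_eq_smul_one, resolvent] using h

theorem localSpectrum_subset_spectrum [CompleteSpace Y] (T : Y →L[ℂ] Y) (y : Y) :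
    localSpectrum T y ⊆ spectrum ℂ T := by
  refine compl_subset_compl.2 fun z hz => ⟨resolventSet ℂ T,
    ⟨spectrum.isOpen_resolventSet T, fun z => -(resolvent T z y), ?_, fun w hw => ?_⟩, hz⟩
  · refine DifferentiableOn.analyticOnNhd (fun w hw => ?_) (spectrum.isOpen_resolventSet T)
    have h1 := (spectrum.hasDerivAt_resolvent_const_left hw).differentiableAt
    exact ((h1.clm_apply (differentiableAt_const y)).neg).differentiableWithinAt
  · rw [map_neg, smul_neg, neg_sub_neg, ← neg_sub, resolvent_apply_of_mem hw, neg_neg]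

theorem localSpectrum_zero (T : Y →L[ℂ] Y) : localSpectrum T 0 = ∅ := by
  refine compl_empty_iff.2 (eq_univ_of_univ_subset fun z _ => ⟨univ, ⟨isOpen_univ, fun _ => 0,
    analyticOnNhd_const, fun w _ => by simp⟩, mem_univ z⟩)

theorem localSpectrum_subset_restrict (T : Y →L[ℂ] Y) {M : Submodule ℂ Y}
    (hM : ∀ y ∈ M, T y ∈ M) (y : M) :
    localSpectrum T (y : Y) ⊆ localSpectrum (T.restrict hM) y := by
  refine compl_subset_compl.2 ?_
  rintro z ⟨U, ⟨hU, g, hg, hgy⟩, hz⟩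
  refine ⟨U, ⟨hU, fun w => M.subtypeL (g w), fun w hw =>
    (M.subtypeL.analyticAt _).comp (hg w hw), fun w hw => ?_⟩, hz⟩
  have := congrArg M.subtypeL (hgy w hw)
  simpa using this

theorem coe_restrict_pow (T : Y →L[ℂ] Y) {M : Submodule ℂ Y} (hM : ∀ y ∈ M, T y ∈ M) (n : ℕ)
    (y : M) : (((T.restrict hM) ^ n) y : Y) = (T ^ n) y := by
  induction n generalizing y with
  | zero => rfl
  | succ n ih => rw [pow_succ, pow_succ, mul_apply_eq_comp, mul_apply_eq_comp, ih]; rfl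

/-- A point of the resolvent set of `T` belongs to that of the restriction to `M` as soon as the
resolvent leaves `M` invariant. -/
theorem mem_resolventSet_restrict {T : Y →L[ℂ] Y} {M : Submodule ℂ Y} (hM : ∀ y ∈ M, T y ∈ M)
    {z : ℂ} (hz : z ∈ resolventSet ℂ T) (h : ∀ y ∈ M, resolvent T z y ∈ M) :
    z ∈ resolventSet ℂ (T.restrict hM) := by
  refine isUnit_iff_exists.2 ⟨(resolvent T z).restrict h, ?_, ?_⟩
  · ext y
    have := resolvent_apply_of_mem hz (y : Y)
    rw [← neg_inj, neg_sub] at this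
    simpa [Algebra.algebraMap_eq_smul_one] using this
  · ext y
    simpa [Algebra.algebraMap_eq_smul_one] using resolvent_apply_sub hz (y : Y)

theorem resolvent_mem_of_mem_resolventSet_restrict {T : Y →L[ℂ] Y} {M : Submodule ℂ Y}
    (hM : ∀ y ∈ M, T y ∈ M) {z : ℂ} (hz : z ∈ resolventSet ℂ T)
    (hzM : z ∈ resolventSet ℂ (T.restrict hM)) {y : Y} (hy : y ∈ M) : resolvent T z y ∈ M := by
  have h1 := congrArg (Subtype.val : M → Y) (resolvent_apply_of_mem hzM ⟨y, hy⟩)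
  set x := resolvent (T.restrict hM) z ⟨y, hy⟩
  have h2 : z • (x : Y) - T x = y := by
    rw [← neg_inj, neg_sub]
    simpa using h1
  rw [← h2, resolvent_apply_sub hz]
  exact x.2

/-- A connected subset of the resolvent set of `T` either consists of spectral points of the
restriction of `T` to a closed invariant subspace, or contains none. -/
theorem subset_resolventSet_restrict [CompleteSpace Y] {T : Y →L[ℂ] Y} {M : Submodule ℂ Y}
    (hMc : IsClosed (M : Set Y)) (hM : ∀ y ∈ M, T y ∈ M) {H : Set ℂ} (hH : IsPreconnected H)
    (hHo : IsOpen H) (hHT : H ⊆ resolventSet ℂ T)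
    (hne : (H ∩ resolventSet ℂ (T.restrict hM)).Nonempty) :
    H ⊆ resolventSet ℂ (T.restrict hM) := by
  have : CompleteSpace M := hMc.completeSpace_coe
  refine hH.subset_of_closure_inter_subset
    (spectrum.isOpen_resolventSet (𝕜 := ℂ) (T.restrict hM)) hne ?_
  rintro z ⟨hzc, hzH⟩
  refine mem_resolventSet_restrict hM (hHT hzH) fun y hy => ?_
  have hcont : Tendsto (fun w => resolvent T w y) (𝓝 z) (𝓝 (resolvent T z y)) :=
    (((spectrum.hasDerivAt_resolvent_const_left (hHT hzH)).differentiableAt).clm_apply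
      (differentiableAt_const y)).continuousAt
  refine hMc.mem_of_frequently_of_tendsto ?_ hcont
  refine ((mem_closure_iff_frequently.1 hzc).and_eventually (hHo.mem_nhds hzH)).mono ?_
  rintro w ⟨hw, hwH⟩
  exact resolvent_mem_of_mem_resolventSet_restrict hM (hHT hwH) hw hy

theorem le_of_forall_pow_le {x R C : ℝ} (hR : 0 < R) (h : ∀ n : ℕ, x ^ n ≤ C * R ^ n) : x ≤ R := by
  by_contra! hx
  have h1 : 1 < x / R := by rwa [one_lt_div hR]
  obtain ⟨n, hn⟩ := pow_unbounded_of_one_lt C h1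
  rw [div_pow, lt_div_iff₀ (by positivity)] at hn
  exact (h n).not_gt hn

theorem norm_le_of_mem_spectrum [CompleteSpace Y] {T : Y →L[ℂ] Y} {R C : ℝ} (hR : 0 < R)
    (hT : ∀ n : ℕ, ‖T ^ n‖ ≤ C * R ^ n) {z : ℂ} (hz : z ∈ spectrum ℂ T) : ‖z‖ ≤ R := by
  refine le_of_forall_pow_le (C := C * ‖(1 : Y →L[ℂ] Y)‖) hR fun n => ?_
  rw [← norm_pow]
  refine (spectrum.norm_le_norm_mul_of_mem (spectrum.pow_mem_pow T n hz)).trans ?_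
  calc ‖T ^ n‖ * ‖(1 : Y →L[ℂ] Y)‖ ≤ C * R ^ n * ‖(1 : Y →L[ℂ] Y)‖ := by
        gcongr
        exact hT n
    _ = _ := by ring

theorem tendsto_ofReal_mul_pow_rpow {c ρ : ℝ} (hc : 0 < c) (hρ : 0 < ρ) :
    Tendsto (fun n : ℕ => ENNReal.ofReal (c * ρ ^ n) ^ (1 / n : ℝ)) atTop
      (𝓝 (ENNReal.ofReal ρ)) := by
  have h1 : Tendsto (fun n : ℕ => c ^ (1 / n : ℝ) * ρ) atTop (𝓝 ρ) := by
    have h2 : Tendsto (fun n : ℕ => c ^ (1 / n : ℝ)) atTop (𝓝 (c ^ (0 : ℝ))) :=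
      tendsto_const_nhds.rpow tendsto_one_div_atTop_nhds_zero_nat (Or.inl hc.ne')
    simpa using h2.mul_const ρ
  refine (ENNReal.tendsto_ofReal h1).congr' ?_
  filter_upwards [eventually_gt_atTop 0] with n hn
  have hn' : (n : ℝ) ≠ 0 := by exact_mod_cast hn.ne'
  rw [ENNReal.ofReal_rpow_of_nonneg (by positivity) (by positivity),
    Real.mul_rpow hc.le (by positivity), ← Real.rpow_natCast ρ n, ← Real.rpow_mul hρ.le,
    mul_one_div_cancel hn', Real.rpow_one]

/-- The operator `T` is invertible, with powers growing at most like `e^(a|L||n|)`, and there is a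
separating family of eigenvectors `ℓ s` of the adjoint, with eigenvalues `e^(sL)`, depending
analytically on the parameter `s` in the strip `|Re s| < a`. -/
structure HasAnalyticEigenfamily (T : Y →L[ℂ] Y) (L a : ℝ) (ℓ : ℂ → StrongDual ℂ Y) : Prop where
  L_ne : L ≠ 0
  a_pos : 0 < a
  eigen : ∀ s : ℂ, |s.re| < a → ∀ y, ℓ s (T y) = Complex.exp (s * L) * ℓ s y
  differentiableOn : ∀ y, DifferentiableOn ℂ (fun s => ℓ s y) {s | |s.re| < a}
  separating : ∀ y, (∀ s : ℂ, |s.re| < a → ℓ s y = 0) → y = 0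
  exists_bound : ∃ C, 0 < C ∧ ∀ n : ℕ, ‖T ^ n‖ ≤ C * Real.exp (a * |L|) ^ n
  exists_inverse : ∃ S : Y →L[ℂ] Y, T * S = 1 ∧ S * T = 1 ∧
    ∃ C, 0 < C ∧ ∀ n : ℕ, ‖S ^ n‖ ≤ C * Real.exp (a * |L|) ^ n

namespace HasAnalyticEigenfamily

variable {T : Y →L[ℂ] Y} {L a : ℝ} {ℓ : ℂ → StrongDual ℂ Y}

theorem isOpen_strip (a : ℝ) : IsOpen {s : ℂ | |s.re| < a} :=
  isOpen_lt (continuous_abs.comp continuous_re) continuous_const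

theorem isPreconnected_strip (a : ℝ) : IsPreconnected {s : ℂ | |s.re| < a} := by
  have : {s : ℂ | |s.re| < a} = re ⁻¹' Ioo (-a) a := by
    ext s; simp [abs_lt]
  rw [this]
  exact ((convex_Ioo (-a) a).linear_preimage reLm).isPreconnected

theorem eq_zero_of_eventually (h : HasAnalyticEigenfamily T L a ℓ) {y : Y} {s₀ : ℂ}
    (hs₀ : |s₀.re| < a) (h0 : ∀ᶠ s in 𝓝 s₀, ℓ s y = 0) : y = 0 :=
  h.separating y fun _ hs =>
    (((h.differentiableOn y).analyticOnNhd (isOpen_strip a)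
      ).eqOn_zero_of_preconnected_of_eventuallyEq_zero (isPreconnected_strip a) hs₀ h0) hs

theorem abs_L_pos (h : HasAnalyticEigenfamily T L a ℓ) : 0 < |L| := abs_pos.2 h.L_ne

theorem one_lt_exp (h : HasAnalyticEigenfamily T L a ℓ) : 1 < Real.exp (a * |L|) :=
  Real.one_lt_exp_iff.2 (mul_pos h.a_pos h.abs_L_pos)

/-- Every point of the open annulus is of the form `e^(sL)` with `s` in the strip. -/
theorem exists_exp_eq (h : HasAnalyticEigenfamily T L a ℓ) {μ : ℂ}
    (hμ : (Real.exp (a * |L|))⁻¹ < ‖μ‖) (hμ' : ‖μ‖ < Real.exp (a * |L|)) :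
    ∃ s : ℂ, |s.re| < a ∧ Complex.exp (s * L) = μ := by
  have hμ0 : 0 < ‖μ‖ := (by positivity : (0 : ℝ) < (Real.exp (a * |L|))⁻¹).trans hμ
  have hL : (L : ℂ) ≠ 0 := ofReal_ne_zero.2 h.L_ne
  refine ⟨Complex.log μ / L, ?_, ?_⟩
  · rw [Complex.div_ofReal_re, Complex.log_re, abs_div, div_lt_iff₀ h.abs_L_pos, abs_lt]
    refine ⟨?_, ?_⟩
    · rw [← Real.exp_neg] at hμ
      exact (Real.lt_log_iff_exp_lt hμ0).2 hμ
    · exact (Real.log_lt_iff_lt_exp hμ0).2 hμ'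
  · rw [div_mul_cancel₀ _ hL, Complex.exp_log (norm_pos_iff.1 hμ0)]

theorem pointSpectrum_eq_empty (h : HasAnalyticEigenfamily T L a ℓ) : pointSpectrum T = ∅ := by
  refine eq_empty_of_forall_notMem fun μ hμ => ?_
  obtain ⟨y, hy⟩ := Module.End.HasEigenvalue.exists_hasEigenvector hμ
  have hTy : T y = μ • y := hy.apply_eq_smul
  obtain ⟨s₀, hs₀, hne⟩ : ∃ s₀ : ℂ, |s₀.re| < a ∧ Complex.exp (s₀ * L) ≠ μ := by
    by_contra! hcon
    have h1 := hcon 0 (by simpa using h.a_pos)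
    have h2 := hcon ((a / 2 : ℝ) : ℂ) (by
      rw [ofReal_re, abs_of_pos (half_pos h.a_pos)]
      linarith [h.a_pos])
    rw [zero_mul, Complex.exp_zero] at h1
    rw [← h1, ← ofReal_mul, ← ofReal_exp, ofReal_eq_one, Real.exp_eq_one_iff] at h2
    exact (mul_ne_zero (half_pos h.a_pos).ne' h.L_ne) h2
  refine hy.2 (h.eq_zero_of_eventually hs₀ ?_)
  have hc : ContinuousAt (fun s : ℂ => Complex.exp (s * L)) s₀ := by fun_prop
  filter_upwards [hc.eventually_ne hne, (isOpen_strip a).mem_nhds hs₀] with s hs hsa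
  have h1 := h.eigen s hsa y
  rw [hTy, map_smul, smul_eq_mul] at h1
  have h2 : (Complex.exp (s * L) - μ) * ℓ s y = 0 := by linear_combination -h1
  exact (mul_eq_zero.1 h2).resolve_left (sub_ne_zero.2 hs)

/-- Every open set that meets the closed annulus meets the open annulus. -/
theorem exists_mem_open_annulus {R : ℝ} (hR : 1 < R) {U : Set ℂ} (hU : IsOpen U) {μ : ℂ}
    (hμU : μ ∈ U) (hμ : R⁻¹ ≤ ‖μ‖) (hμ' : ‖μ‖ ≤ R) : ∃ ν ∈ U, R⁻¹ < ‖ν‖ ∧ ‖ν‖ < R := by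
  have hμ0 : 0 < ‖μ‖ := (by positivity : (0 : ℝ) < R⁻¹).trans_le hμ
  set l := Real.log ‖μ‖ with hl
  have hR0 : 0 < R := by linarith
  have hlR : 0 < Real.log R := Real.log_pos hR
  have hl1 : -Real.log R ≤ l := by
    rw [← Real.log_inv]
    exact Real.log_le_log (by positivity) hμ
  have hl2 : l ≤ Real.log R := Real.log_le_log hμ0 hμ'
  have hc : Tendsto (fun ε : ℝ => ((Real.exp (-ε * l) : ℝ) : ℂ) * μ) (𝓝[>] 0) (𝓝 μ) := by
    have h1 : Continuous fun ε : ℝ => ((Real.exp (-ε * l) : ℝ) : ℂ) * μ := by fun_prop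
    have h2 := h1.tendsto 0
    simp only [neg_zero, zero_mul, Real.exp_zero, ofReal_one, one_mul] at h2
    exact h2.mono_left nhdsWithin_le_nhds
  have hev : ∀ᶠ ε : ℝ in 𝓝[>] 0, ε ∈ Ioo (0 : ℝ) 1 := Ioo_mem_nhdsGT zero_lt_one
  obtain ⟨ε, hεU, hε⟩ := ((hc.eventually (hU.mem_nhds hμU)).and hev).exists
  refine ⟨_, hεU, ?_⟩
  have hn : ‖((Real.exp (-ε * l) : ℝ) : ℂ) * μ‖ = Real.exp ((1 - ε) * l) := by
    rw [norm_mul, Complex.norm_of_nonneg (Real.exp_pos _).le, ← Real.exp_log hμ0, ← hl,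
      ← Real.exp_add]
    ring_nf
  have h1 : (1 - ε) * l < Real.log R := by nlinarith [hε.1, hε.2]
  have h2 : -Real.log R < (1 - ε) * l := by nlinarith [hε.1, hε.2]
  rw [hn]
  constructor
  · rw [← Real.exp_log hR0, ← Real.exp_neg]
    exact Real.exp_lt_exp.2 h2
  · exact (Real.lt_log_iff_exp_lt hR0).1 h1

/-- The local spectrum of a nonzero vector contains the annulus: if `(T - z) g(z) = y` near
`z₀ = e^(s₀ L)`, then `ℓ s y = 0` for `s` near `s₀`. -/
theorem annulus_subset_localSpectrum (h : HasAnalyticEigenfamily T L a ℓ) {y : Y} (hy : y ≠ 0) :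
    {μ : ℂ | (Real.exp (a * |L|))⁻¹ ≤ ‖μ‖ ∧ ‖μ‖ ≤ Real.exp (a * |L|)} ⊆ localSpectrum T y := by
  rintro μ ⟨hμ, hμ'⟩ ⟨U, ⟨hU, g, -, hg⟩, hμU⟩
  obtain ⟨ν, hνU, hν, hν'⟩ := exists_mem_open_annulus h.one_lt_exp hU hμU hμ hμ'
  obtain ⟨s₀, hs₀, rfl⟩ := h.exists_exp_eq hν hν'
  refine hy (h.eq_zero_of_eventually hs₀ ?_)
  have hc : ContinuousAt (fun s : ℂ => Complex.exp (s * L)) s₀ := by fun_prop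
  filter_upwards [hc.eventually (hU.mem_nhds hνU), (isOpen_strip a).mem_nhds hs₀] with s hs hsa
  rw [← hg _ hs, map_sub, h.eigen s hsa, map_smul, smul_eq_mul, sub_self]

theorem norm_mem_of_mem_spectrum [CompleteSpace Y] (h : HasAnalyticEigenfamily T L a ℓ) {μ : ℂ}
    (hμ : μ ∈ spectrum ℂ T) : (Real.exp (a * |L|))⁻¹ ≤ ‖μ‖ ∧ ‖μ‖ ≤ Real.exp (a * |L|) := by
  obtain ⟨C, -, hC⟩ := h.exists_bound
  obtain ⟨S, hTS, hST, D, -, hD⟩ := h.exists_inverse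
  refine ⟨?_, norm_le_of_mem_spectrum (Real.exp_pos _) hC hμ⟩
  let u : (Y →L[ℂ] Y)ˣ := ⟨T, S, hTS, hST⟩
  have hμS : μ⁻¹ ∈ spectrum ℂ S := by
    have : μ⁻¹⁻¹ ∈ spectrum ℂ (u : Y →L[ℂ] Y) := by rwa [inv_inv]
    exact spectrum.inv₀_mem_iff.1 this
  have hμ0 : μ ≠ 0 := by
    rintro rfl
    exact (spectrum.zero_notMem_iff ℂ).2 u.isUnit hμ
  have h1 := norm_le_of_mem_spectrum (Real.exp_pos _) hD hμS
  rw [norm_inv] at h1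
  exact inv_le_of_inv_le₀ (norm_pos_iff.2 hμ0) h1

theorem localSpectrum_eq [CompleteSpace Y] (h : HasAnalyticEigenfamily T L a ℓ) {y : Y}
    (hy : y ≠ 0) : localSpectrum T y = spectrum ℂ T :=
  Subset.antisymm (localSpectrum_subset_spectrum T y) fun _ hμ =>
    h.annulus_subset_localSpectrum hy (h.norm_mem_of_mem_spectrum hμ)

theorem spectrum_eq [CompleteSpace Y] [Nontrivial Y] (h : HasAnalyticEigenfamily T L a ℓ) :
    spectrum ℂ T = {μ : ℂ | (Real.exp (a * |L|))⁻¹ ≤ ‖μ‖ ∧ ‖μ‖ ≤ Real.exp (a * |L|)} := by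
  obtain ⟨y, hy⟩ := exists_ne (0 : Y)
  exact Subset.antisymm (fun μ hμ => h.norm_mem_of_mem_spectrum hμ)
    ((h.annulus_subset_localSpectrum hy).trans (localSpectrum_subset_spectrum T y))

theorem localSpectralSubspace_eq [CompleteSpace Y] (h : HasAnalyticEigenfamily T L a ℓ)
    {F : Set ℂ} (hF : F ⊂ spectrum ℂ T) : localSpectralSubspace T F = {0} := by
  ext y
  simp only [localSpectralSubspace, mem_ofPred_eq, mem_singleton_iff]
  constructor
  · intro hy
    by_contra hne
    rw [h.localSpectrum_eq hne] at hy
    exact hF.2 hy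
  · rintro rfl
    rw [localSpectrum_zero]
    exact empty_subset F

theorem spectralRadius_eq [CompleteSpace Y] [Nontrivial Y] (h : HasAnalyticEigenfamily T L a ℓ) :
    spectralRadius ℂ T = ENNReal.ofReal (Real.exp (a * |L|)) := by
  have h1 := h.one_lt_exp
  refine le_antisymm (iSup₂_le fun μ hμ => ?_) ?_
  · rw [← enorm_eq_nnnorm, ← ofReal_norm]
    exact ENNReal.ofReal_le_ofReal (h.norm_mem_of_mem_spectrum hμ).2
  · have hmem : ((Real.exp (a * |L|) : ℝ) : ℂ) ∈ spectrum ℂ T := by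
      rw [h.spectrum_eq, mem_ofPred_eq, Complex.norm_of_nonneg (Real.exp_pos _).le]
      exact ⟨(inv_le_one_of_one_le₀ h1.le).trans h1.le, le_rfl⟩
    refine le_trans (le_of_eq ?_) (le_iSup₂ (f := fun (k : ℂ) (_ : k ∈ spectrum ℂ T) =>
      (‖k‖₊ : ℝ≥0∞)) _ hmem)
    rw [← enorm_eq_nnnorm, ← ofReal_norm, Complex.norm_of_nonneg (Real.exp_pos _).le]

theorem eigen_pow (h : HasAnalyticEigenfamily T L a ℓ) {s : ℂ} (hs : |s.re| < a) (n : ℕ) (y : Y) :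
    ℓ s ((T ^ n) y) = Complex.exp (s * L) ^ n * ℓ s y := by
  induction n generalizing y with
  | zero => simp
  | succ n ih => rw [pow_succ, mul_apply_eq_comp, ih, h.eigen s hs]; ring

/-- Testing against `ℓ s` bounds the growth of `‖Tⁿ y‖` from below. -/
theorem ofReal_le_localSpectralRadius (h : HasAnalyticEigenfamily T L a ℓ) {y : Y} {s : ℂ}
    (hs : |s.re| < a) (hsy : ℓ s y ≠ 0) :
    ENNReal.ofReal (Real.exp (s.re * L)) ≤ localSpectralRadius T y := by
  have hℓ : 0 < ‖ℓ s‖ := norm_pos_iff.2 fun h0 => hsy (by rw [h0]; rfl)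
  have hc : 0 < ‖ℓ s y‖ / ‖ℓ s‖ := div_pos (norm_pos_iff.2 hsy) hℓ
  rw [localSpectralRadius, ← (tendsto_ofReal_mul_pow_rpow hc (Real.exp_pos _)).limsup_eq]
  refine limsup_le_limsup (Eventually.of_forall fun n => ?_)
  refine ENNReal.rpow_le_rpow ?_ (by positivity)
  rw [← ofReal_norm]
  refine ENNReal.ofReal_le_ofReal ?_
  rw [div_mul_eq_mul_div, div_le_iff₀ hℓ, mul_comm ‖(T ^ n) y‖]
  refine le_trans (le_of_eq ?_) ((ℓ s).le_opNorm ((T ^ n) y))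
  rw [h.eigen_pow hs, norm_mul, norm_pow, Complex.norm_exp, Complex.re_mul_ofReal, mul_comm]

theorem localSpectralRadius_eq [CompleteSpace Y] [Nontrivial Y]
    (h : HasAnalyticEigenfamily T L a ℓ) {y : Y} (hy : y ≠ 0) :
    localSpectralRadius T y = spectralRadius ℂ T := by
  rw [h.spectralRadius_eq]
  refine le_antisymm ?_ ?_
  · obtain ⟨C, hC0, hC⟩ := h.exists_bound
    have hc : 0 < C * ‖y‖ := mul_pos hC0 (norm_pos_iff.2 hy)
    rw [localSpectralRadius, ← (tendsto_ofReal_mul_pow_rpow hc (Real.exp_pos _)).limsup_eq]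
    refine limsup_le_limsup (Eventually.of_forall fun n => ?_)
    refine ENNReal.rpow_le_rpow ?_ (by positivity)
    rw [← ofReal_norm]
    refine ENNReal.ofReal_le_ofReal (((T ^ n).le_opNorm y).trans ?_)
    calc ‖T ^ n‖ * ‖y‖ ≤ C * Real.exp (a * |L|) ^ n * ‖y‖ := by gcongr; exact hC n
      _ = _ := by ring
  · -- approximate `e^(a|L|)` by `e^(Re s L)` with `s` in the strip and `ℓ s y ≠ 0`
    refine le_of_forall_lt fun c hc => ?_
    lift c to ℝ≥0 using hc.ne_top
    rw [← ENNReal.ofReal_coe_nnreal, ENNReal.ofReal_lt_ofReal_iff (Real.exp_pos _)] at hc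
    have h1 := h.one_lt_exp
    obtain ⟨x, hx, hxR⟩ := exists_between (max_lt hc h1)
    have hx1 : 1 < x := (le_max_right _ _).trans_lt hx
    have hcx : (c : ℝ) < x := (le_max_left _ _).trans_lt hx
    have hx0 : 0 < x := by linarith
    have hnx : ‖((x : ℝ) : ℂ)‖ = x := Complex.norm_of_nonneg hx0.le
    obtain ⟨s₀, hs₀, hexp⟩ := h.exists_exp_eq (μ := (x : ℂ))
      (by rw [hnx]; exact (inv_lt_one_of_one_lt₀ h1).trans hx1) (by rwa [hnx])
    have hre : Real.exp (s₀.re * L) = x := by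
      rw [← hnx, ← hexp, Complex.norm_exp, Complex.re_mul_ofReal]
    have hfreq : ∃ᶠ s in 𝓝 s₀, ℓ s y ≠ 0 := fun hcon =>
      hy (h.eq_zero_of_eventually hs₀ (hcon.mono fun s hs => not_not.1 hs))
    have hcont : ContinuousAt (fun s : ℂ => Real.exp (s.re * L)) s₀ := by fun_prop
    have hev : ∀ᶠ s in 𝓝 s₀, (c : ℝ) < Real.exp (s.re * L) :=
      hcont.eventually (lt_mem_nhds (hcx.trans_eq hre.symm))
    obtain ⟨s, hsy, hsc, hsa⟩ :=
      (hfreq.and_eventually (hev.and ((isOpen_strip a).mem_nhds hs₀))).exists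
    refine lt_of_lt_of_le ?_ (h.ofReal_le_localSpectralRadius hsa hsy)
    rw [← ENNReal.ofReal_coe_nnreal]
    exact (ENNReal.ofReal_lt_ofReal_iff (Real.exp_pos _)).2 hsc

/-- The spectrum of a restriction contains the annulus and lies in the disc; the hole of the annulus
is connected, so it is either filled or left untouched. -/
theorem restrictionSpectrum_eq [CompleteSpace Y] [Nontrivial Y]
    (h : HasAnalyticEigenfamily T L a ℓ) {M : Submodule ℂ Y} (hMc : IsClosed (M : Set Y))
    (hM0 : M ≠ ⊥) (hM : ∀ y ∈ M, T y ∈ M) :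
    restrictionSpectrum T M hM = spectrum ℂ T ∨
      restrictionSpectrum T M hM = {μ : ℂ | ENNReal.ofReal ‖μ‖ ≤ spectralRadius ℂ T} := by
  have : CompleteSpace M := hMc.completeSpace_coe
  set R := Real.exp (a * |L|) with hR
  have hR0 : 0 < R := Real.exp_pos _
  have hball : {μ : ℂ | ENNReal.ofReal ‖μ‖ ≤ spectralRadius ℂ T} = {μ : ℂ | ‖μ‖ ≤ R} := by
    rw [h.spectralRadius_eq]
    ext μ
    exact ENNReal.ofReal_le_ofReal_iff hR0.le
  obtain ⟨y, hyM, hy⟩ := (Submodule.ne_bot_iff M).1 hM0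
  have hsub : {μ : ℂ | R⁻¹ ≤ ‖μ‖ ∧ ‖μ‖ ≤ R} ⊆ restrictionSpectrum T M hM :=
    (h.annulus_subset_localSpectrum hy).trans
      ((localSpectrum_subset_restrict T hM ⟨y, hyM⟩).trans (localSpectrum_subset_spectrum _ _))
  have hle : ∀ μ ∈ restrictionSpectrum T M hM, ‖μ‖ ≤ R := by
    obtain ⟨C, hC0, hC⟩ := h.exists_bound
    intro μ hμ
    refine norm_le_of_mem_spectrum hR0 (C := C) (fun n => ?_) hμ
    refine ContinuousLinearMap.opNorm_le_bound _ (by positivity) fun x => ?_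
    change ‖(((T.restrict hM) ^ n) x : Y)‖ ≤ C * R ^ n * ‖(x : Y)‖
    rw [coe_restrict_pow]
    refine ((T ^ n).le_opNorm x).trans ?_
    exact mul_le_mul_of_nonneg_right (hC n) (norm_nonneg _)
  rw [hball, h.spectrum_eq]
  by_cases hne : (ball (0 : ℂ) R⁻¹ ∩ resolventSet ℂ (T.restrict hM)).Nonempty
  · left
    have hhole := subset_resolventSet_restrict hMc hM (convex_ball (0 : ℂ) R⁻¹).isPreconnected
      isOpen_ball (fun μ hμ => by
        by_contra hcon
        have := (h.norm_mem_of_mem_spectrum (μ := μ) hcon).1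
        rw [mem_ball_zero_iff] at hμ
        linarith) hne
    refine Subset.antisymm (fun μ hμ => ⟨?_, hle μ hμ⟩) hsub
    by_contra! hcon
    exact hμ (hhole (mem_ball_zero_iff.2 hcon))
  · right
    refine Subset.antisymm hle fun μ hμ => ?_
    rcases le_or_gt R⁻¹ ‖μ‖ with h1 | h1
    · exact hsub ⟨h1, hμ⟩
    · by_contra hcon
      exact hne ⟨μ, mem_ball_zero_iff.2 h1, not_not.1 hcon⟩

end HasAnalyticEigenfamily

end LocalSpectralTheory

/-! ### The adjoint of a hyperbolic composition operator -/

section Adjoint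

variable {X : Type*} [NormedAddCommGroup X] [NormedSpace ℂ X]

@[simp] theorem dualOperator_apply (C : X →L[ℂ] X) (f : StrongDual ℂ X) (x : X) :
    dualOperator C f x = f (C x) := rfl

theorem dualOperator_mul (A B : X →L[ℂ] X) :
    dualOperator A * dualOperator B = dualOperator (B * A) := rfl

theorem dualOperator_one : dualOperator (1 : X →L[ℂ] X) = 1 := rfl

set_option synthInstance.maxHeartbeats 200000 in
theorem dualOperator_pow (C : X →L[ℂ] X) (n : ℕ) : dualOperator C ^ n = dualOperator (C ^ n) := by
  induction n with
  | zero => rfl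
  | succ n ih => rw [pow_succ, ih, dualOperator_mul, ← pow_succ']

theorem norm_dualOperator_le (C : X →L[ℂ] X) : ‖dualOperator C‖ ≤ ‖C‖ := by
  refine ContinuousLinearMap.opNorm_le_bound _ (norm_nonneg C) fun f => ?_
  rw [mul_comm]
  exact f.opNorm_comp_le C

end Adjoint

namespace BoundaryPair

variable (b : BoundaryPair)

theorem norm_dualOperator_flowComp_pow_le (hp : p ≠ ⊤) (x : ℝ) (n : ℕ) :
    ‖dualOperator (b.flowComp (p := p) hp x) ^ n‖ ≤
      (16 / ‖b.α - b.β‖ ^ 2) ^ (1 / p.toReal) * Real.exp (1 / p.toReal * |x|) ^ n := by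
  rw [dualOperator_pow, b.flowComp_pow]
  refine (norm_dualOperator_le _).trans ((b.norm_flowComp_le hp _).trans (le_of_eq ?_))
  rw [← Real.exp_nat_mul, abs_mul, Nat.abs_cast]
  ring_nf

/-- Pairing with the eigenfunctions `v^s` gives an analytic eigenfamily for the adjoint of a
hyperbolic composition operator. -/
theorem hasAnalyticEigenfamily (hpp : 1 < p) (hp : p ≠ ⊤) {x : ℝ} (hx : x ≠ 0) :
    HasAnalyticEigenfamily (dualOperator (b.flowComp (p := p) hp x)) x (1 / p.toReal)
      (fun s => ContinuousLinearMap.apply ℂ ℂ (b.powerElt p s)) where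
  L_ne := hx
  a_pos := by
    have := one_le_toReal hp1.out hp
    positivity
  eigen s hs f := by
    rw [ContinuousLinearMap.apply_apply, ContinuousLinearMap.apply_apply, dualOperator_apply,
      b.flowComp_powerElt hp hs, map_smul, smul_eq_mul]
  differentiableOn f s hs := by
    obtain ⟨d, hd⟩ := b.exists_hasDerivAt_powerElt hp hs
    exact (f.differentiableAt.comp s hd.differentiableAt).differentiableWithinAt
  separating f hf := b.eq_zero_of_forall_powerElt hpp hp f hf
  exists_bound := by
    have := norm_pos_iff.2 b.sub_ne
    exact ⟨_, by positivity, b.norm_dualOperator_flowComp_pow_le hp x⟩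
  exists_inverse := by
    have := norm_pos_iff.2 b.sub_ne
    refine ⟨dualOperator (b.flowComp hp (-x)), ?_, ?_,
      (16 / ‖b.α - b.β‖ ^ 2) ^ (1 / p.toReal), by positivity, fun n => ?_⟩
    · rw [dualOperator_mul, b.flowComp_mul, neg_add_cancel, b.flowComp_zero, dualOperator_one]
    · rw [dualOperator_mul, b.flowComp_mul, add_neg_cancel, b.flowComp_zero, dualOperator_one]
    · simpa only [abs_neg] using b.norm_dualOperator_flowComp_pow_le hp (-x) n

theorem nontrivial_dual (hp : p ≠ ⊤) : Nontrivial (StrongDual ℂ (HardySpace p)) := by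
  refine ⟨⟨HardySpace.evalCLM hp 0, 0, fun h => ?_⟩⟩
  have h1 := congrArg (fun f : StrongDual ℂ (HardySpace p) => f (HardySpace.ofPolynomial hp 1)) h
  simp at h1

end BoundaryPair

end HardyComp

end

theorem mainTheorem4 (p : ENNReal) [Fact (1 ≤ p)] (hp1 : 1 < p) (hp : p ≠ ⊤)
    (φ : Complex.UnitDisc → Complex.UnitDisc) (hφ : HardyComp.IsHyperbolicAutomorphism φ) :
    ∃ C : HardyComp.HardySpace p →L[ℂ] HardyComp.HardySpace p,
      HardyComp.IsCompositionOperator φ C ∧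
      HardyComp.pointSpectrum (HardyComp.dualOperator C) = ∅ ∧
      (∀ F : Set ℂ, IsClosed F → F ⊂ spectrum ℂ (HardyComp.dualOperator C) →
        HardyComp.localSpectralSubspace (HardyComp.dualOperator C) F = {0}) ∧
      (∀ f : StrongDual ℂ (HardyComp.HardySpace p), f ≠ 0 →
        HardyComp.localSpectrum (HardyComp.dualOperator C) f =
          spectrum ℂ (HardyComp.dualOperator C)) ∧
      (∀ f : StrongDual ℂ (HardyComp.HardySpace p), f ≠ 0 →
        HardyComp.localSpectralRadius (HardyComp.dualOperator C) f =
          spectralRadius ℂ (HardyComp.dualOperator C)) ∧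
      (∃ R : ℝ, 1 < R ∧ spectralRadius ℂ (HardyComp.dualOperator C) = ENNReal.ofReal R ∧
        spectrum ℂ (HardyComp.dualOperator C) = {μ : ℂ | R⁻¹ ≤ ‖μ‖ ∧ ‖μ‖ ≤ R}) ∧
      (∀ M : Submodule ℂ (StrongDual ℂ (HardyComp.HardySpace p)),
        IsClosed (M : Set (StrongDual ℂ (HardyComp.HardySpace p))) → M ≠ ⊥ →
        ∀ hM : ∀ f ∈ M, HardyComp.dualOperator C f ∈ M,
          HardyComp.restrictionSpectrum (HardyComp.dualOperator C) M hM =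
              spectrum ℂ (HardyComp.dualOperator C) ∨
            HardyComp.restrictionSpectrum (HardyComp.dualOperator C) M hM =
              {μ : ℂ | ENNReal.ofReal ‖μ‖ ≤
                spectralRadius ℂ (HardyComp.dualOperator C)}) := by
  obtain ⟨b, x, hx, rfl⟩ := hφ.exists_eq_flow
  have h := b.hasAnalyticEigenfamily hp1 hp hx
  have := HardyComp.BoundaryPair.nontrivial_dual hp
  exact ⟨b.flowComp hp x, fun f z => rfl, h.pointSpectrum_eq_empty,
    fun F _ hF => h.localSpectralSubspace_eq hF, fun f hf => h.localSpectrum_eq hf,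
    fun f hf => h.localSpectralRadius_eq hf, ⟨_, h.one_lt_exp, h.spectralRadius_eq, h.spectrum_eq⟩,
    fun M hMc hM0 hM => h.restrictionSpectrum_eq hMc hM0 hM⟩
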